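/- Theorem 1.1. Let $N\ge 1$, $\gamma\in\mathbf N$ with $\gamma\ge 1$, $d>0$, $L>0$, and let $G:\mathbf R^N\times(0,\infty)\to\mathbf R$ satisfy the following condition (G): (i) $G\in C^\gamma(\mathbf R^N\times(0,\infty))$; (ii) $G(x,t)=t^{-N/d}\,G(t^{-1/d}x,1)$ for all $x\in\mathbf R^N$, $t>0$, and $\sup_{x\in\mathbf R^N}(1+|x|)^{N+L+j}|\nabla_x^jG(x,1)|<\infty$ for $j=0,\dots,\gamma$; (iii) $G(x,t)=\int_{\mathbf R^N}G(x-y,t-s)G(y,s)\,dy$ for all $x\in\mathbf R^N$ and $t>s>0$. For $k\ge 0$ let $[k]$ be the integer part of $k$, let $|||f|||_k:=\int_{\mathbf R^N}|f(x)|(1+|x|^k)\,dx$, and let $L^1_k$ be the space of measurable $f:\mathbf R^N\to\mathbf R$ with $|||f|||_k<\infty$. Let $\|\cdot\|_q$ be the norm of $L^q(\mathbf R^N)$. Put $e^{t\mathcal L}\varphi(x):=\int_{\mathbf R^N}G(x-y,t)\varphi(y)\,dy$ and, for a multi-index $\alpha$, $$g_\alpha(x,t):=\frac{(-1)^{|\alpha|}}{\alpha!}\,\partial_x^\alpha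 G(x,t+1),$$ $$M_\alpha(f,t):=\int_{\mathbf R^N}x^\alpha f(x)\,dx-\sum_{\beta\le\alpha,\ \beta\ne\alpha}M_\beta(f,t)\int_{\mathbf R^N}x^\alpha g_\beta(x,t)\,dx ,$$ the latter inductively in $\alpha$, where $\beta\le\alpha$ is meant componentwise (so that $M_0(f,t)=\int_{\mathbf R^N} f\,dx$). Let $0\le K<L$ with $[K]+1\le\gamma$. For $\varphi\in L^1_K$ put $$v(x,t):=e^{t\mathcal L}\varphi(x)-\sum_{|\alpha|\le K}M_\alpha(\varphi,0)\,g_\alpha(x,t).$$ Then $v(\cdot,t)\in C^\gamma(\mathbf R^N)$ for every $\varphi\in L^1_K$ and $t>0$. For all $j\in\{0,\dots,\gamma\}$, $q\in[1,\infty]$ and $\ell\in[0,K]$ there exists a constant $C$, independent of $\varphi$ and $t$, such that $$t^{\frac Nd(1-\frac1q)+\frac jd}\|\nabla^jv(t)\|_q+t^{\frac jd}(1+t)^{-\frac \ell d}|||\nabla^jv(t)|||_\ell\le C(1+t)^{-\frac Kd}|||\varphi|||_K$$ for all $\varphi\in L^1_K$ and $t>0$. Furthermore, for every $\varphi\in L^1_K$,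 $$\lim_{t\to\infty}t^{\frac Kd}\Big[t^{\frac Nd(1-\frac1q)+\frac jd}\|\nabla^jv(t)\|_q+t^{-\frac \ell d+\frac jd}|||\nabla^jv(t)|||_\ell\Big]=0 .$$ -/

import Mathlib

open MeasureTheory Filter Topology
open scoped ENNReal

namespace GenHeat

noncomputable section

/-- The space `ℝ^N` with its Euclidean norm. -/
abbrev Space (N : ℕ) : Type := EuclideanSpace ℝ (Fin N)

/-! ### Multi-indices -/

/-- `|α| = α_1 + ⋯ + α_N`. -/
def order {N : ℕ} (α : Fin N → ℕ) : ℕ := ∑ i, α i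

/-- `α! = α_1! ⋯ α_N!`. -/
def multiFactorial {N : ℕ} (α : Fin N → ℕ) : ℕ := ∏ i, (α i).factorial

/-- `x^α = x_1^{α_1} ⋯ x_N^{α_N}`. -/
def monomial {N : ℕ} (α : Fin N → ℕ) (x : Space N) : ℝ := ∏ i, x i ^ α i

/-- The finite set of the multi-indices `α` with `|α| ≤ k`, for real `k ≥ 0`. -/
def multiIndices (N : ℕ) (k : ℝ) : Finset (Fin N → ℕ) :=
  (Finset.Iic (fun _ : Fin N => ⌊k⌋₊)).filter (fun α => order α ≤ ⌊k⌋₊)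

theorem mem_multiIndices {N : ℕ} {k : ℝ} (hk : 0 ≤ k) (α : Fin N → ℕ) :
    α ∈ multiIndices N k ↔ (order α : ℝ) ≤ k := by
  rw [multiIndices, Finset.mem_filter, Finset.mem_Iic, ← Nat.le_floor_iff hk]
  refine ⟨fun h => h.2, fun h => ⟨fun i => le_trans ?_ h, h⟩⟩
  exact Finset.single_le_sum (f := α) (fun _ _ => Nat.zero_le _) (Finset.mem_univ i)

theorem order_lt_order {N : ℕ} {α β : Fin N → ℕ} (h : β < α) : order β < order α := by
  obtain ⟨hle, i, hi⟩ := Pi.lt_def.1 h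
  exact Finset.sum_lt_sum (fun j _ => hle j) ⟨i, Finset.mem_univ i, hi⟩

/-- The partial derivative `∂f/∂x_i`. -/
def partialDeriv {N : ℕ} (i : Fin N) (f : Space N → ℝ) : Space N → ℝ :=
  fun x => lineDeriv ℝ f x (EuclideanSpace.single i (1 : ℝ))

/-- `∂^α f = ∂_1^{α_1} (∂_2^{α_2} ( ⋯ ∂_N^{α_N} f))`. -/
def multiDeriv {N : ℕ} (α : Fin N → ℕ) (f : Space N → ℝ) : Space N → ℝ :=
  (List.finRange N).foldr (fun i h => (partialDeriv i)^[α i] h) f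

/-! ### Weighted `L¹` spaces -/

/-- The norm `∫ |f(x)| (1 + |x|^k) dx`, with values in `[0, ∞]`. -/
def weightedNorm {N : ℕ} {F : Type*} [NormedAddCommGroup F] (k : ℝ) (f : Space N → F) : ℝ≥0∞ :=
  ∫⁻ x, ‖f x‖ₑ * ENNReal.ofReal (1 + ‖x‖ ^ k)

/-- Membership in the space `L¹(ℝ^N, (1 + |x|^k) dx)`. -/
def MemWeightedL1 {N : ℕ} (k : ℝ) (f : Space N → ℝ) : Prop :=
  AEStronglyMeasurable f volume ∧ weightedNorm k f < ∞

/-! ### The kernel -/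

/-- The generalized heat kernels `G = G(x, t)`, `x ∈ ℝ^N`, `t > 0`, with smoothness `γ`,
scaling exponent `d` and decay exponent `N + L`. -/
structure IsGeneralizedHeatKernel {N : ℕ} (γ : ℕ) (d L : ℝ) (G : Space N → ℝ → ℝ) : Prop where
  smoothness_pos : 0 < γ
  d_pos : 0 < d
  L_pos : 0 < L
  contDiffOn : ContDiffOn ℝ γ (fun p : Space N × ℝ => G p.1 p.2) (Set.univ ×ˢ Set.Ioi 0)
  scaling : ∀ (x : Space N) (t : ℝ), 0 < t →
    G x t = t ^ (-((N : ℝ) / d)) * G ((t ^ (1 / d))⁻¹ • x) 1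
  decay : ∀ j : ℕ, j ≤ γ → BddAbove (Set.range fun x : Space N =>
    (1 + ‖x‖) ^ ((N : ℝ) + L + j) * ‖iteratedFDeriv ℝ j (fun y => G y 1) x‖)
  semigroup : ∀ (x : Space N) (s t : ℝ), 0 < s → s < t →
    G x t = ∫ y, G (x - y) (t - s) * G y s

/-- `(e^{tL} φ)(x) = ∫ G(x - y, t) φ(y) dy`. -/
def evolution {N : ℕ} (G : Space N → ℝ → ℝ) (t : ℝ) (φ : Space N → ℝ) (x : Space N) : ℝ :=
  ∫ y, G (x - y) t * φ y

/-- `g_α(x, t) = ((-1)^{|α|} / α!) ∂_x^α g(x, t)`, where `g(x, t) = G(x, t + 1)`. -/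
def gKernel {N : ℕ} (G : Space N → ℝ → ℝ) (α : Fin N → ℕ) (x : Space N) (t : ℝ) : ℝ :=
  (-1) ^ order α / (multiFactorial α : ℝ) * multiDeriv α (fun y => G y (t + 1)) x

/-- The modified moments `M_α(f, t)`, by recursion on `α`:
`M_α(f, t) = ∫ x^α f(x) dx - ∑_{β ≤ α, β ≠ α} M_β(f, t) ∫ x^α g_β(x, t) dx`.
For `α = 0` the sum is empty and `M_0(f, t) = ∫ f(x) dx`. -/
def modMoment {N : ℕ} (G : Space N → ℝ → ℝ) (f : Space N → ℝ) (t : ℝ) (α : Fin N → ℕ) : ℝ :=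
  (∫ x, monomial α x * f x) -
    ∑ β : {β : Fin N → ℕ // β ∈ Finset.Iio α},
      modMoment G f t β.1 * ∫ x, monomial α x * gKernel G β.1 x t
termination_by order α
decreasing_by exact order_lt_order (Finset.mem_Iio.1 β.2)

theorem modMoment_eq {N : ℕ} (G : Space N → ℝ → ℝ) (f : Space N → ℝ) (t : ℝ) (α : Fin N → ℕ) :
    modMoment G f t α = (∫ x, monomial α x * f x) -
      ∑ β ∈ Finset.Iio α, modMoment G f t β * ∫ x, monomial α x * gKernel G β x t := by
  rw [modMoment]
  congr 1
  exact Finset.sum_coe_sort (Finset.Iio α)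
    (fun β => modMoment G f t β * ∫ x, monomial α x * gKernel G β x t)

/-- The remainder `v(x, t) = (e^{tL} φ)(x) - ∑_{|α| ≤ K} M_α(φ, 0) g_α(x, t)`. -/
def remainder {N : ℕ} (G : Space N → ℝ → ℝ) (K : ℝ) (φ : Space N → ℝ) (t : ℝ) (x : Space N) : ℝ :=
  evolution G t φ x - ∑ α ∈ multiIndices N K, modMoment G φ 0 α * gKernel G α x t

end

end GenHeat

/-! By scaling, `G(·, t)` is the `L¹`-normalized dilation, with factor `s = t^{1/d}`, of the single
profile `G(·, 1)`, whose derivatives of order `j` decay like `(1 + |x|)^{-(N + L + j)}`. The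
evolution is therefore convolution with a dilated profile.

The semigroup law gives `g_α(·, t) = e^{tL} g_α(·, 0)`. By linearity `v(t) = e^{tL} ψ`, where `ψ = φ
- ∑ M_α(φ, 0) g_α(·, 0)` (`remainder_eq`). It also forces `∫ G(·, 1) = 1` unless `G` vanishes
identically (`integral_eq_one_or_eq_zero`). When the mass is one, the matrix `∫ x^α g_β(x, 0) dx` is
triangular for the componentwise order with unit diagonal. The recursion for `M_α` is then exactly
what makes all moments of `ψ` of order at most `K` vanish (`integral_monomial_mul_corrected`), while
`|||ψ|||_K` stays bounded by a multiple of `|||φ|||_K`.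

For data with vanishing moments the Taylor polynomial of the profile of degree `k = [K]` may be
subtracted under the integral. The weighted `L¹` mass of the Taylor remainder at displacement `η = y
/ s` is `O(|η|^K)` for every `η` and `O(|η|^{k+1})` for `|η| ≤ 1` (`exists_remainderMass_le`). The
first bound yields decay of `|||v|||_ℓ` at the rate `s^{ℓ-K}`. As `K < k + 1`, the second bound
together with dominated convergence upgrades this rate to `o(s^{ℓ-K})`.

Only `v` itself is treated this way, which is why `[K] + 1` derivatives of the profile suffice.
Derivatives and `L^q` norms follow from `v(t) = e^{(t/2)L} v(t/2)` (`conv_dilate_half`) and the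
direct smoothing estimates for `e^{(t/2)L}` (`exists_norms_remainder_le`). -/

namespace GenHeat
noncomputable section

/-! ### Smooth functions with algebraic decay -/

/-- `f` is `C^n` and its derivatives of order `j ≤ n` are `O((1 + |x|)^{-(p + j)})`. -/
structure HasDecay {N : ℕ} (n : ℕ) (p : ℝ) (f : Space N → ℝ) : Prop where
  contDiff : ContDiff ℝ n f
  bound : ∀ j : ℕ, j ≤ n → ∃ C : ℝ, 0 ≤ C ∧ ∀ x,
    ‖iteratedFDeriv ℝ j f x‖ ≤ C * (1 + ‖x‖) ^ (-(p + j))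

theorem HasDecay.mono {N n m : ℕ} {p q : ℝ} {f : Space N → ℝ} (hf : HasDecay n p f)
    (hm : m ≤ n) (hq : q ≤ p) : HasDecay m q f := by
  refine ⟨hf.contDiff.of_le (by exact_mod_cast hm), fun j hj => ?_⟩
  obtain ⟨C, hC, h⟩ := hf.bound j (hj.trans hm)
  refine ⟨C, hC, fun x => (h x).trans ?_⟩
  gcongr
  linarith [norm_nonneg x]

theorem partialDeriv_eq_fderiv {N : ℕ} (i : Fin N) {f : Space N → ℝ} (hf : Differentiable ℝ f) :
    partialDeriv i f = fun x => fderiv ℝ f x (EuclideanSpace.single i (1 : ℝ)) := by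
  funext x
  exact (hf x).lineDeriv_eq_fderiv

theorem HasDecay.partialDeriv {N n : ℕ} {p : ℝ} {f : Space N → ℝ} (hf : HasDecay (n + 1) p f)
    (i : Fin N) : HasDecay n (p + 1) (partialDeriv i f) := by
  have hd : Differentiable ℝ f := hf.contDiff.differentiable (by simp)
  have hf' : ContDiff ℝ n (fderiv ℝ f) := hf.contDiff.fderiv_right (by norm_cast)
  rw [partialDeriv_eq_fderiv i hd]
  refine ⟨hf'.clm_apply contDiff_const, fun j hj => ?_⟩
  obtain ⟨C, hC, h⟩ := hf.bound (j + 1) (by omega)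
  refine ⟨C, hC, fun x => ?_⟩
  calc _ ≤ ‖EuclideanSpace.single i (1 : ℝ)‖ * ‖iteratedFDeriv ℝ j (fderiv ℝ f) x‖ :=
        norm_iteratedFDeriv_clm_apply_const hf'.contDiffAt (by exact_mod_cast hj)
    _ = ‖iteratedFDeriv ℝ (j + 1) f x‖ := by
        rw [norm_iteratedFDeriv_fderiv]; simp
    _ ≤ _ := by
        refine (h x).trans_eq ?_
        push_cast
        ring_nf

theorem HasDecay.iterate_partialDeriv {N n : ℕ} (b : ℕ) {p : ℝ} {f : Space N → ℝ}
    (hf : HasDecay (n + b) p f) (i : Fin N) :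
    HasDecay n (p + b) ((GenHeat.partialDeriv i)^[b] f) := by
  induction b generalizing n p with
  | zero => simpa using hf
  | succ b ih =>
    rw [Function.iterate_succ_apply']
    have := (ih (n := n + 1) (p := p) (by convert hf using 1; omega)).partialDeriv i
    convert this using 1
    push_cast; ring

theorem HasDecay.foldr_partialDeriv {N n : ℕ} (α : Fin N → ℕ) (l : List (Fin N)) {p : ℝ}
    {f : Space N → ℝ} (hf : HasDecay (n + (l.map α).sum) p f) :
    HasDecay n (p + (l.map α).sum)
      (l.foldr (fun i h => (GenHeat.partialDeriv i)^[α i] h) f) := by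
  induction l generalizing n with
  | nil => simpa using hf
  | cons i l ih =>
    have h := (ih (n := n + α i) (by
      convert hf using 1; simp only [List.map_cons, List.sum_cons]; omega)).iterate_partialDeriv
        (α i) i
    simp only [List.foldr_cons]
    convert h using 1
    simp only [List.map_cons, List.sum_cons]; push_cast; ring

theorem sum_map_finRange {N : ℕ} (α : Fin N → ℕ) : ((List.finRange N).map α).sum = order α := by
  rw [order, ← List.ofFn_eq_map, List.sum_ofFn]

theorem HasDecay.multiDeriv {N n : ℕ} (α : Fin N → ℕ) {p : ℝ} {f : Space N → ℝ}
    (hf : HasDecay (n + order α) p f) : HasDecay n (p + order α) (multiDeriv α f) := by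
  have := HasDecay.foldr_partialDeriv (n := n) α (List.finRange N) (p := p) (f := f)
  rw [sum_map_finRange] at this
  exact this hf

theorem HasDecay.exists_norm_le {N n : ℕ} {p : ℝ} {f : Space N → ℝ} (hf : HasDecay n p f)
    (hp : 0 ≤ p) {j : ℕ} (hj : j ≤ n) : ∃ C, 0 ≤ C ∧ ∀ x, ‖iteratedFDeriv ℝ j f x‖ ≤ C := by
  obtain ⟨C, hC, h⟩ := hf.bound j hj
  refine ⟨C, hC, fun x => (h x).trans (mul_le_of_le_one_right hC ?_)⟩
  exact Real.rpow_le_one_of_one_le_of_nonpos (by linarith [norm_nonneg x])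
    (by have : (0 : ℝ) ≤ j := j.cast_nonneg
        linarith)

theorem HasDecay.abs_le {N n : ℕ} {p : ℝ} {f : Space N → ℝ} (hf : HasDecay n p f) :
    ∃ C, 0 ≤ C ∧ ∀ x, |f x| ≤ C * (1 + ‖x‖) ^ (-p) := by
  obtain ⟨C, hC, h⟩ := hf.bound 0 (Nat.zero_le _)
  exact ⟨C, hC, fun x => by simpa using h x⟩

theorem integrable_one_add_norm_rpow {N : ℕ} {r : ℝ} (hr : N < r) :
    Integrable (fun x : Space N => (1 + ‖x‖) ^ (-r)) :=
  integrable_one_add_norm (by simpa using hr)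

theorem HasDecay.integrable_weight_mul {N n : ℕ} {p ℓ : ℝ} {f : Space N → ℝ} (hf : HasDecay n p f)
    {j : ℕ} (hj : j ≤ n) (hp : N + ℓ < p) :
    Integrable (fun x => (1 + ‖x‖) ^ ℓ * ‖iteratedFDeriv ℝ j f x‖) := by
  obtain ⟨C, hC, h⟩ := hf.bound j hj
  have hj0 : (0 : ℝ) ≤ j := j.cast_nonneg
  have hcf : Continuous (iteratedFDeriv ℝ j f) :=
    hf.contDiff.continuous_iteratedFDeriv (by exact_mod_cast hj)
  refine ((integrable_one_add_norm_rpow (r := p + j - ℓ) (by linarith)).const_mul C).mono'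
    ?_ (Eventually.of_forall fun x => ?_)
  · refine Continuous.aestronglyMeasurable (Continuous.mul ?_ hcf.norm)
    exact Continuous.rpow_const (by fun_prop) fun x => Or.inl (by positivity)
  · have h1 : 0 < 1 + ‖x‖ := by positivity
    rw [Real.norm_of_nonneg (by positivity)]
    calc _ ≤ (1 + ‖x‖) ^ ℓ * (C * (1 + ‖x‖) ^ (-(p + j))) := by gcongr; exact h x
      _ = C * ((1 + ‖x‖) ^ ℓ * (1 + ‖x‖) ^ (-(p + j))) := by ring
      _ = _ := by rw [← Real.rpow_add h1]; ring_nf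

/-! ### Convolution with an integrable function -/

/-- `(f * ψ)(x) = ∫ f(x - y) ψ(y) dy`. -/
def conv {N : ℕ} (f ψ : Space N → ℝ) (x : Space N) : ℝ := ∫ y, f (x - y) * ψ y

theorem integrable_comp_sub_smul {N : ℕ} {F : Type*} [NormedAddCommGroup F] [NormedSpace ℝ F]
    {f : Space N → F} {ψ : Space N → ℝ} (hf : Continuous f) {C : ℝ} (hb : ∀ x, ‖f x‖ ≤ C)
    (hψ : Integrable ψ) (x : Space N) : Integrable (fun y => ψ y • f (x - y)) := by
  refine hψ.smul_bdd C ?_ (Eventually.of_forall fun y => hb (x - y))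
  exact (hf.comp (continuous_sub_left x)).aestronglyMeasurable

theorem integrable_comp_sub_mul {N : ℕ} {f ψ : Space N → ℝ} (hf : Continuous f) {C : ℝ}
    (hb : ∀ x, |f x| ≤ C) (hψ : Integrable ψ) (x : Space N) :
    Integrable (fun y => f (x - y) * ψ y) := by
  simpa [mul_comm] using integrable_comp_sub_smul hf hb hψ x

/-- All derivatives fall on `f`, and `C' |ψ|` dominates the differentiated integrand. The values lie
in a general Banach space so that the lemma applies again to each `iteratedFDeriv ℝ m f`. -/
theorem hasFDerivAt_integral_comp_sub {N : ℕ} {F : Type*} [NormedAddCommGroup F] [NormedSpace ℝ F]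
    [CompleteSpace F]
    {f : Space N → F} {ψ : Space N → ℝ} (hf : ContDiff ℝ 1 f) {C C' : ℝ} (hb : ∀ x, ‖f x‖ ≤ C)
    (hb' : ∀ x, ‖fderiv ℝ f x‖ ≤ C') (hψ : Integrable ψ) (x : Space N) :
    HasFDerivAt (fun x => ∫ y, ψ y • f (x - y)) (∫ y, ψ y • fderiv ℝ f (x - y)) x := by
  have hc' : Continuous (fderiv ℝ f) := hf.continuous_fderiv (by simp)
  refine hasFDerivAt_integral_of_dominated_of_fderiv_le (s := Set.univ)
    (F' := fun x y => ψ y • fderiv ℝ f (x - y)) (bound := fun y => |ψ y| * C')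
    univ_mem (Eventually.of_forall fun z => (integrable_comp_sub_smul hf.continuous hb hψ z).1)
    (integrable_comp_sub_smul hf.continuous hb hψ x)
    (integrable_comp_sub_smul hc' hb' hψ x).1 ?_ (hψ.abs.mul_const _) ?_
  · refine Eventually.of_forall fun y z _ => ?_
    rw [norm_smul, Real.norm_eq_abs]
    gcongr
    exact hb' _
  · refine Eventually.of_forall fun y z _ => ?_
    have h1 : HasFDerivAt f (fderiv ℝ f (z - y)) (z - y) :=
      (hf.differentiable (by simp) _).hasFDerivAt
    exact (h1.comp z ((hasFDerivAt_id z).sub_const y)).const_smul (ψ y)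

theorem integral_fderiv_comp_sub_apply {N : ℕ} {F : Type*} [NormedAddCommGroup F]
    [NormedSpace ℝ F] [CompleteSpace F] {f : Space N → F} {ψ : Space N → ℝ} (hf : ContDiff ℝ 1 f)
    {C' : ℝ} (hb' : ∀ x, ‖fderiv ℝ f x‖ ≤ C') (hψ : Integrable ψ) (x v : Space N) :
    (∫ y, ψ y • fderiv ℝ f (x - y)) v = ∫ y, ψ y • fderiv ℝ f (x - y) v :=
  ContinuousLinearMap.integral_apply
    (integrable_comp_sub_smul (hf.continuous_fderiv (by simp)) hb' hψ x) v

theorem integrable_fderiv_comp_sub_apply {N : ℕ} {F : Type*} [NormedAddCommGroup F]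
    [NormedSpace ℝ F] {f : Space N → F} {ψ : Space N → ℝ} (hf : ContDiff ℝ 1 f)
    {C' : ℝ} (hb' : ∀ x, ‖fderiv ℝ f x‖ ≤ C') (hψ : Integrable ψ) (x v : Space N) :
    Integrable (fun y => ψ y • fderiv ℝ f (x - y) v) :=
  (integrable_comp_sub_smul (hf.continuous_fderiv (by simp)) hb' hψ x).apply_continuousLinearMap v

/-- Exhibiting the whole Taylor series at once yields both the regularity of the convolution and a
formula for its iterated derivatives, from which every later norm estimate starts. -/
theorem hasFTaylorSeriesUpTo_conv {N n : ℕ} {f ψ : Space N → ℝ} (hf : ContDiff ℝ n f)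
    (hb : ∀ j : ℕ, j ≤ n → ∃ C, 0 ≤ C ∧ ∀ x, ‖iteratedFDeriv ℝ j f x‖ ≤ C) (hψ : Integrable ψ) :
    HasFTaylorSeriesUpTo n (conv f ψ)
      (fun x m => ∫ y, ψ y • iteratedFDeriv ℝ m f (x - y)) := by
  have hint : ∀ j : ℕ, j ≤ n → ∀ x, Integrable (fun y => ψ y • iteratedFDeriv ℝ j f (x - y)) := by
    intro j hj x
    obtain ⟨C, -, hC⟩ := hb j hj
    exact integrable_comp_sub_smul (hf.continuous_iteratedFDeriv (by exact_mod_cast hj)) hC hψ x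
  have hder : ∀ m : ℕ, m < n → ∀ x, HasFDerivAt (fun x => ∫ y, ψ y • iteratedFDeriv ℝ m f (x - y))
      ((∫ y, ψ y • iteratedFDeriv ℝ (m + 1) f (x - y)).curryLeft) x := by
    intro m hm x
    obtain ⟨C, -, hC⟩ := hb m hm.le
    obtain ⟨C', -, hC'⟩ := hb (m + 1) hm
    have h1 : ContDiff ℝ 1 (iteratedFDeriv ℝ m f) :=
      hf.iteratedFDeriv_right (by norm_cast; omega)
    have := hasFDerivAt_integral_comp_sub h1 hC (C' := C')
      (fun x => by rw [norm_fderiv_iteratedFDeriv]; exact hC' x) hψ x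
    refine this.congr_fderiv ?_
    ext v w
    rw [integral_fderiv_comp_sub_apply h1
      (fun x => by rw [norm_fderiv_iteratedFDeriv]; exact hC' x) hψ x,
      ContinuousMultilinearMap.curryLeft_apply,
      ContinuousMultilinearMap.integral_apply (hint _ hm x),
      ContinuousMultilinearMap.integral_apply (integrable_fderiv_comp_sub_apply h1
      (fun x => by rw [norm_fderiv_iteratedFDeriv]; exact hC' x) hψ x v)]
    rfl
  refine ⟨fun x => ?_, fun m hm x => hder m (by exact_mod_cast hm) x, fun m hm => ?_⟩
  · rw [ContinuousMultilinearMap.curry0_apply,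
      ContinuousMultilinearMap.integral_apply (hint 0 (Nat.zero_le _) x)]
    simp [conv, mul_comm]
  · have hm' : m ≤ n := by exact_mod_cast hm
    obtain ⟨C, -, hC⟩ := hb m hm'
    have hc := hf.continuous_iteratedFDeriv (m := m) (by exact_mod_cast hm')
    refine continuous_of_dominated (bound := fun y => |ψ y| * C) (fun x => (hint m hm' x).1)
      (fun x => Eventually.of_forall fun y => ?_) (hψ.abs.mul_const _)
      (Eventually.of_forall fun y => ?_)
    · rw [norm_smul, Real.norm_eq_abs]
      gcongr
      exact hC _
    · exact (hc.comp (continuous_sub_right y)).const_smul (ψ y)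

theorem contDiff_conv {N n : ℕ} {p : ℝ} {f ψ : Space N → ℝ} (hf : HasDecay n p f) (hp : 0 ≤ p)
    (hψ : Integrable ψ) : ContDiff ℝ n (conv f ψ) :=
  (hasFTaylorSeriesUpTo_conv hf.contDiff (fun _ hj => hf.exists_norm_le hp hj) hψ).contDiff

theorem enorm_iteratedFDeriv_conv_le {N n : ℕ} {p : ℝ} {f ψ : Space N → ℝ} (hf : HasDecay n p f)
    (hp : 0 ≤ p) (hψ : Integrable ψ) {j : ℕ} (hj : j ≤ n) (x : Space N) :
    ‖iteratedFDeriv ℝ j (conv f ψ) x‖ₑ ≤ ∫⁻ y, ‖iteratedFDeriv ℝ j f (x - y)‖ₑ * ‖ψ y‖ₑ := by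
  rw [← (hasFTaylorSeriesUpTo_conv hf.contDiff
    (fun _ hj => hf.exists_norm_le hp hj) hψ).eq_iteratedFDeriv (by exact_mod_cast hj) x]
  refine (enorm_integral_le_lintegral_enorm _).trans_eq ?_
  simp only [enorm_smul, mul_comm]

theorem conv_comm {N : ℕ} (f ψ : Space N → ℝ) : conv f ψ = conv ψ f := by
  funext x
  rw [conv, ← integral_sub_left_eq_self _ _ x]
  simp [conv, mul_comm]

theorem partialDeriv_conv {N n : ℕ} {p : ℝ} {f ψ : Space N → ℝ} (hf : HasDecay (n + 1) p f)
    (hp : 0 ≤ p) (hψ : Integrable ψ) (i : Fin N) :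
    partialDeriv i (conv f ψ) = conv (partialDeriv i f) ψ := by
  obtain ⟨C, -, hC⟩ := hf.exists_norm_le hp (Nat.zero_le _)
  obtain ⟨C', -, hC'⟩ := hf.exists_norm_le hp (j := 1) (by omega)
  have h1 : ContDiff ℝ 1 f := hf.contDiff.of_le (by norm_cast; omega)
  have hb : ∀ x, ‖f x‖ ≤ C := fun x => by simpa using hC x
  have hb' : ∀ x, ‖fderiv ℝ f x‖ ≤ C' := fun x => by simpa using hC' x
  have hD := hasFDerivAt_integral_comp_sub h1 hb hb' hψ
  have e : conv f ψ = fun x => ∫ y, ψ y • f (x - y) := by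
    funext x; simp [conv, mul_comm]
  rw [partialDeriv_eq_fderiv i (h1.differentiable (by simp)), e,
    partialDeriv_eq_fderiv i (fun x => (hD x).differentiableAt)]
  funext x
  rw [(hD x).fderiv, ContinuousLinearMap.integral_apply
    (integrable_comp_sub_smul (h1.continuous_fderiv (by simp)) hb' hψ x)]
  simp [conv, mul_comm]

theorem iterate_partialDeriv_conv {N n : ℕ} (b : ℕ) {p : ℝ} {f ψ : Space N → ℝ}
    (hf : HasDecay (n + b) p f) (hp : 0 ≤ p) (hψ : Integrable ψ) (i : Fin N) :
    (partialDeriv i)^[b] (conv f ψ) = conv ((partialDeriv i)^[b] f) ψ := by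
  induction b generalizing n with
  | zero => rfl
  | succ b ih =>
    have hf' : HasDecay (n + 1 + b) p f := by convert hf using 1; omega
    rw [Function.iterate_succ_apply', Function.iterate_succ_apply', ih hf',
      partialDeriv_conv (hf'.iterate_partialDeriv b i) (by positivity) hψ]

theorem multiDeriv_conv {N n : ℕ} (α : Fin N → ℕ) {p : ℝ} {f ψ : Space N → ℝ}
    (hf : HasDecay (n + order α) p f) (hp : 0 ≤ p) (hψ : Integrable ψ) :
    multiDeriv α (conv f ψ) = conv (multiDeriv α f) ψ := by
  have key : ∀ (l : List (Fin N)) (n : ℕ), HasDecay (n + (l.map α).sum) p f →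
      l.foldr (fun i h => (partialDeriv i)^[α i] h) (conv f ψ) =
        conv (l.foldr (fun i h => (partialDeriv i)^[α i] h) f) ψ := by
    intro l
    induction l with
    | nil => intros; rfl
    | cons i l ih =>
      intro n h
      have h' : HasDecay (n + α i + (l.map α).sum) p f := by
        convert h using 1; simp only [List.map_cons, List.sum_cons]; omega
      simp only [List.foldr_cons]
      rw [ih _ h', iterate_partialDeriv_conv _ (h'.foldr_partialDeriv α l) (by positivity) hψ]
  refine key (List.finRange N) n ?_
  rwa [sum_map_finRange]

/-! ### Dilations -/

/-- The `L¹`-normalized dilation `s^{-N} f(x / s)`. -/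
def dilate {N : ℕ} (s : ℝ) (f : Space N → ℝ) (x : Space N) : ℝ := (s ^ N)⁻¹ * f (s⁻¹ • x)

theorem norm_iteratedFDeriv_dilate {N n : ℕ} {s : ℝ} (hs : 0 < s) {f : Space N → ℝ}
    (hf : ContDiff ℝ n f) {j : ℕ} (hj : j ≤ n) (x : Space N) :
    ‖iteratedFDeriv ℝ j (dilate s f) x‖ =
      (s ^ N)⁻¹ * (s⁻¹ ^ j * ‖iteratedFDeriv ℝ j f (s⁻¹ • x)‖) := by
  have hf' : ContDiff ℝ j f := hf.of_le (by exact_mod_cast hj)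
  have h1 : ContDiff ℝ j (fun x => f (s⁻¹ • x)) := hf'.comp (contDiff_id.const_smul s⁻¹)
  have h2 : iteratedFDeriv ℝ j (dilate s f) x
      = (s ^ N)⁻¹ • iteratedFDeriv ℝ j (fun x => f (s⁻¹ • x)) x :=
    iteratedFDeriv_const_smul_apply' (a := (s ^ N)⁻¹) h1.contDiffAt
  rw [h2, iteratedFDeriv_comp_const_smul _ hf', norm_smul, norm_smul,
    Real.norm_of_nonneg (by positivity), Real.norm_of_nonneg (by positivity)]

/-- The constants obtained here depend on `s`. The lemma serves regularity and integrability only;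
sharp powers of `s` come from `norm_iteratedFDeriv_dilate`. -/
theorem HasDecay.dilate {N n : ℕ} {p s : ℝ} (hs : 0 < s) (hp : 0 ≤ p) {f : Space N → ℝ}
    (hf : HasDecay n p f) : HasDecay n p (dilate s f) := by
  refine ⟨contDiff_const.mul (hf.contDiff.comp (contDiff_id.const_smul s⁻¹)), fun j hj => ?_⟩
  obtain ⟨C, hC, h⟩ := hf.bound j hj
  set r : ℝ := p + j
  have hr : 0 ≤ r := by positivity
  refine ⟨(s ^ N)⁻¹ * (s⁻¹ ^ j * (C * (1 + s) ^ r)), by positivity, fun x => ?_⟩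
  rw [norm_iteratedFDeriv_dilate hs hf.contDiff hj, mul_assoc, mul_assoc, mul_assoc]
  gcongr
  refine (h _).trans ?_
  gcongr
  have h1 : 1 + ‖x‖ ≤ (1 + s) * (1 + ‖s⁻¹ • x‖) := by
    have : ‖x‖ = s * ‖s⁻¹ • x‖ := by
      rw [norm_smul, Real.norm_of_nonneg (by positivity)]; field_simp
    rw [this]
    nlinarith [norm_nonneg (s⁻¹ • x)]
  have h2 : (1 + ‖x‖) ^ r ≤ (1 + s) ^ r * (1 + ‖s⁻¹ • x‖) ^ r := by
    rw [← Real.mul_rpow (by positivity) (by positivity)]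
    gcongr
  rw [Real.rpow_neg (by positivity), Real.rpow_neg (by positivity), ← div_eq_mul_inv,
    le_div_iff₀ (by positivity), inv_mul_le_iff₀ (by positivity), mul_comm]
  exact h2

/-- No measurability of `h` is needed, since a dilation is a measurable equivalence. -/
theorem lintegral_comp_inv_smul {N : ℕ} {s : ℝ} (hs : 0 < s) (h : Space N → ℝ≥0∞) :
    ∫⁻ x, h (s⁻¹ • x) = ENNReal.ofReal (s ^ N) * ∫⁻ z, h z := by
  have hs' : s⁻¹ ≠ 0 := (inv_pos.2 hs).ne'
  have h1 : Measure.map (s⁻¹ • · : Space N → Space N) volume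
      = ENNReal.ofReal (s ^ N) • volume := by
    rw [Measure.map_addHaar_smul _ hs']
    congr 2
    simp [abs_of_pos hs]
  have h2 := lintegral_map_equiv (μ := (volume : Measure (Space N))) h
    (MeasurableEquiv.smul₀ (α := Space N) s⁻¹ hs')
  simp only [MeasurableEquiv.coe_smul₀] at h2
  rw [← h2, h1, lintegral_smul_measure, smul_eq_mul]

/-- Substitute `z = (x - y) / s`. The normalization absorbs the Jacobian, so each derivative costs
one factor `s⁻¹` and the remaining dependence on `s` sits in the weight. -/
theorem lintegral_iteratedFDeriv_dilate_mul {N n : ℕ} {s : ℝ} (hs : 0 < s) {f : Space N → ℝ}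
    (hf : ContDiff ℝ n f) {j : ℕ} (hj : j ≤ n) (h : Space N → ℝ≥0∞) (y : Space N) :
    ∫⁻ x, ‖iteratedFDeriv ℝ j (dilate s f) (x - y)‖ₑ * h x =
      ENNReal.ofReal (s⁻¹ ^ j) * ∫⁻ z, ‖iteratedFDeriv ℝ j f z‖ₑ * h (s • z + y) := by
  have h0 : 0 < s⁻¹ ^ j := by positivity
  have h1 : ∀ x, ‖iteratedFDeriv ℝ j (dilate s f) x‖ₑ =
      ENNReal.ofReal ((s ^ N)⁻¹ * s⁻¹ ^ j) * ‖iteratedFDeriv ℝ j f (s⁻¹ • x)‖ₑ := by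
    intro x
    rw [← ofReal_norm, norm_iteratedFDeriv_dilate hs hf hj, ← ofReal_norm,
      ← ENNReal.ofReal_mul (by positivity), mul_assoc]
  calc _ = ∫⁻ x, ‖iteratedFDeriv ℝ j (dilate s f) x‖ₑ * h (x + y) := by
        rw [← lintegral_add_right_eq_self _ y]
        simp
    _ = ∫⁻ x, ENNReal.ofReal ((s ^ N)⁻¹ * s⁻¹ ^ j) *
          (‖iteratedFDeriv ℝ j f (s⁻¹ • x)‖ₑ * h (s • (s⁻¹ • x) + y)) := by
        congr 1; funext x
        rw [h1, smul_inv_smul₀ hs.ne', mul_assoc]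
    _ = _ := by
        rw [lintegral_const_mul' _ _ ENNReal.ofReal_ne_top,
          lintegral_comp_inv_smul hs (fun z => ‖iteratedFDeriv ℝ j f z‖ₑ * h (s • z + y)),
          ← mul_assoc, ← ENNReal.ofReal_mul (by positivity)]
        congr 2
        field_simp

theorem lintegral_lintegral_mul_weight {N : ℕ} {k : Space N → Space N → ℝ≥0∞}
    {ρ h : Space N → ℝ≥0∞} (hk : Measurable (Function.uncurry k)) (hρ : AEMeasurable ρ)
    (hh : Measurable h) :
    ∫⁻ x, (∫⁻ y, k x y * ρ y) * h x = ∫⁻ y, ρ y * ∫⁻ x, k x y * h x := by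
  have e1 : ∀ x, (∫⁻ y, k x y * ρ y) * h x = ∫⁻ y, k x y * ρ y * h x := fun x =>
    (lintegral_mul_const'' _ (AEMeasurable.mul (by fun_prop) hρ)).symm
  have e2 : ∀ y, ρ y * ∫⁻ x, k x y * h x = ∫⁻ x, k x y * ρ y * h x := fun y => by
    rw [← lintegral_const_mul _ (by fun_prop)]
    congr 1; funext x; ring
  simp only [e1, e2]
  refine lintegral_lintegral_swap ?_
  have : AEMeasurable (fun z : Space N × Space N => ρ z.2) (volume.prod volume) :=
    hρ.comp_snd
  exact (hk.aemeasurable.mul this).mul (by fun_prop)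

/-! ### Weights -/

/-- The weight `1 + |x|^ℓ` with values in `[0, ∞]`. -/
def weight {N : ℕ} (ℓ : ℝ) (x : Space N) : ℝ≥0∞ := ENNReal.ofReal (1 + ‖x‖ ^ ℓ)

theorem weightedNorm_eq {N : ℕ} {F : Type*} [NormedAddCommGroup F] (ℓ : ℝ) (f : Space N → F) :
    weightedNorm ℓ f = ∫⁻ x, ‖f x‖ₑ * weight ℓ x := rfl

theorem measurable_weight {N : ℕ} (ℓ : ℝ) : Measurable (weight (N := N) ℓ) := by
  unfold weight; fun_prop

theorem one_le_weight {N : ℕ} (ℓ : ℝ) (x : Space N) : 1 ≤ weight ℓ x := by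
  rw [weight, ENNReal.one_le_ofReal]
  linarith [Real.rpow_nonneg (norm_nonneg x) ℓ]

theorem lintegral_enorm_le_weightedNorm {N : ℕ} {F : Type*} [NormedAddCommGroup F] (ℓ : ℝ)
    (f : Space N → F) : ∫⁻ x, ‖f x‖ₑ ≤ weightedNorm ℓ f :=
  lintegral_mono fun x => le_mul_of_one_le_right' (one_le_weight ℓ x)

theorem rpow_le_one_add_rpow {a ℓ K : ℝ} (ha : 0 ≤ a) (hℓ : 0 ≤ ℓ) (hK : ℓ ≤ K) :
    a ^ ℓ ≤ 1 + a ^ K := by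
  rcases le_total a 1 with h | h
  · have := Real.rpow_le_one ha h hℓ
    linarith [Real.rpow_nonneg ha K]
  · linarith [Real.rpow_le_rpow_of_exponent_le h hK]

theorem weight_le {N : ℕ} {ℓ K : ℝ} (hℓ : 0 ≤ ℓ) (hK : ℓ ≤ K) (x : Space N) :
    weight ℓ x ≤ 2 * weight K x := by
  have h2 : 2 * weight K x = ENNReal.ofReal (2 * (1 + ‖x‖ ^ K)) := by
    rw [weight, ENNReal.ofReal_mul (by norm_num), ENNReal.ofReal_ofNat]
  rw [h2, weight]
  refine ENNReal.ofReal_le_ofReal ?_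
  linarith [rpow_le_one_add_rpow (norm_nonneg x) hℓ hK, Real.rpow_nonneg (norm_nonneg x) K]

theorem weightedNorm_le {N : ℕ} {F : Type*} [NormedAddCommGroup F] {ℓ K : ℝ} (hℓ : 0 ≤ ℓ)
    (hK : ℓ ≤ K) (f : Space N → F) : weightedNorm ℓ f ≤ 2 * weightedNorm K f := by
  rw [weightedNorm_eq, weightedNorm_eq, ← lintegral_const_mul' _ _ (by simp)]
  refine lintegral_mono fun x => ?_
  calc _ ≤ ‖f x‖ₑ * (2 * weight K x) := by gcongr; exact weight_le hℓ hK x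
    _ = _ := by ring

theorem MemWeightedL1.integrable {N : ℕ} {K : ℝ} {f : Space N → ℝ} (hf : MemWeightedL1 K f) :
    Integrable f :=
  ⟨hf.1, (lintegral_enorm_le_weightedNorm K f).trans_lt hf.2⟩

theorem add_rpow_le {a b ℓ : ℝ} (ha : 0 ≤ a) (hb : 0 ≤ b) (hℓ : 0 ≤ ℓ) :
    (a + b) ^ ℓ ≤ 2 ^ ℓ * (a ^ ℓ + b ^ ℓ) := by
  have h1 : a + b ≤ 2 * max a b := by linarith [le_max_left a b, le_max_right a b]
  calc (a + b) ^ ℓ ≤ (2 * max a b) ^ ℓ := by gcongr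
    _ = 2 ^ ℓ * max a b ^ ℓ := Real.mul_rpow (by norm_num) (le_max_of_le_left ha)
    _ ≤ _ := by
      gcongr
      rcases max_choice a b with h | h <;> rw [h]
      · linarith [Real.rpow_nonneg hb ℓ]
      · linarith [Real.rpow_nonneg ha ℓ]

/-- Separates the profile variable `z` from `y` and `s`: the factor in `z` is integrated against the
decaying profile, the other against the datum. -/
theorem weight_smul_add_le {N : ℕ} {ℓ s : ℝ} (hℓ : 0 ≤ ℓ) (hs : 0 < s) (z y : Space N) :
    weight ℓ (s • z + y) ≤ ENNReal.ofReal (2 ^ ℓ * (1 + ‖z‖) ^ ℓ) *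
      (weight ℓ y + ENNReal.ofReal (s ^ ℓ)) := by
  rw [weight, weight, ← ENNReal.ofReal_add (by positivity) (by positivity),
    ← ENNReal.ofReal_mul (by positivity)]
  refine ENNReal.ofReal_le_ofReal ?_
  have h1 : ‖s • z + y‖ ^ ℓ ≤ (s * ‖z‖ + ‖y‖) ^ ℓ := by
    gcongr
    refine (norm_add_le _ _).trans ?_
    rw [norm_smul, Real.norm_of_nonneg hs.le]
  have h2 := add_rpow_le (ℓ := ℓ) (show 0 ≤ s * ‖z‖ by positivity) (norm_nonneg y) hℓ
  rw [Real.mul_rpow hs.le (norm_nonneg z)] at h2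
  have h3 : ‖z‖ ^ ℓ ≤ (1 + ‖z‖) ^ ℓ := by gcongr; linarith
  have h4 : 1 ≤ (1 + ‖z‖) ^ ℓ := Real.one_le_rpow (by linarith [norm_nonneg z]) hℓ
  have h5 : (1 : ℝ) ≤ 2 ^ ℓ := Real.one_le_rpow (by norm_num) hℓ
  have h6 : 1 ≤ 2 ^ ℓ * (1 + ‖z‖) ^ ℓ := one_le_mul_of_one_le_of_one_le h5 h4
  have h7 : s ^ ℓ * ‖z‖ ^ ℓ + ‖y‖ ^ ℓ ≤ (1 + ‖z‖) ^ ℓ * (s ^ ℓ + ‖y‖ ^ ℓ) := by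
    have := mul_le_mul_of_nonneg_left h3 (Real.rpow_nonneg hs.le ℓ)
    have := mul_le_mul_of_nonneg_left h4 (Real.rpow_nonneg (norm_nonneg y) ℓ)
    nlinarith
  calc 1 + ‖s • z + y‖ ^ ℓ
      ≤ 2 ^ ℓ * (1 + ‖z‖) ^ ℓ + 2 ^ ℓ * ((1 + ‖z‖) ^ ℓ * (s ^ ℓ + ‖y‖ ^ ℓ)) := by
        refine add_le_add h6 (h1.trans (h2.trans ?_))
        gcongr
    _ = _ := by ring

/-! ### Direct estimates -/

/-- By Tonelli the weight is integrated against the kernel first. The term with `s ^ ℓ` reflects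
that the kernel carries mass to distance of order `s`. -/
theorem weightedNorm_iteratedFDeriv_conv_dilate_le {N n : ℕ} {p ℓ : ℝ} {f : Space N → ℝ}
    (hf : HasDecay n p f) (hℓ : 0 ≤ ℓ) (hp : N + ℓ < p) {j : ℕ} (hj : j ≤ n) :
    ∃ C : ℝ, 0 ≤ C ∧ ∀ s : ℝ, 0 < s → ∀ ψ : Space N → ℝ, Integrable ψ →
      weightedNorm ℓ (iteratedFDeriv ℝ j (conv (dilate s f) ψ)) ≤
        ENNReal.ofReal (C * s⁻¹ ^ j) *
          (weightedNorm ℓ ψ + ENNReal.ofReal (s ^ ℓ) * ∫⁻ x, ‖ψ x‖ₑ) := by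
  have hp0 : 0 ≤ p := by linarith [(N.cast_nonneg : (0 : ℝ) ≤ N)]
  have hI := hf.integrable_weight_mul hj hp
  set A : ℝ := ∫ z, (1 + ‖z‖) ^ ℓ * ‖iteratedFDeriv ℝ j f z‖ with hA
  have hA0 : 0 ≤ A := integral_nonneg fun z => by positivity
  have hA' : ∫⁻ z, ‖iteratedFDeriv ℝ j f z‖ₑ * ENNReal.ofReal (2 ^ ℓ * (1 + ‖z‖) ^ ℓ) =
      ENNReal.ofReal (2 ^ ℓ * A) := by
    rw [hA, ← integral_const_mul, ofReal_integral_eq_lintegral_ofReal (hI.const_mul _)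
      (Eventually.of_forall fun z => by positivity)]
    congr 1; funext z
    rw [← ofReal_norm, ← ENNReal.ofReal_mul (norm_nonneg _)]
    congr 1; ring
  refine ⟨2 ^ ℓ * A, by positivity, fun s hs ψ hψ => ?_⟩
  have hfs := hf.dilate hs hp0
  have hc : Continuous (iteratedFDeriv ℝ j (dilate s f)) :=
    hfs.contDiff.continuous_iteratedFDeriv (by exact_mod_cast hj)
  have hρ : AEMeasurable (fun y => ‖ψ y‖ₑ) := hψ.1.enorm
  calc weightedNorm ℓ (iteratedFDeriv ℝ j (conv (dilate s f) ψ))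
      ≤ ∫⁻ x, (∫⁻ y, ‖iteratedFDeriv ℝ j (dilate s f) (x - y)‖ₑ * ‖ψ y‖ₑ) * weight ℓ x := by
        rw [weightedNorm_eq]
        gcongr with x
        exact enorm_iteratedFDeriv_conv_le hfs hp0 hψ hj x
    _ = ∫⁻ y, ‖ψ y‖ₑ * ∫⁻ x, ‖iteratedFDeriv ℝ j (dilate s f) (x - y)‖ₑ * weight ℓ x := by
        refine lintegral_lintegral_mul_weight
          (k := fun x y => ‖iteratedFDeriv ℝ j (dilate s f) (x - y)‖ₑ) ?_ hρ (measurable_weight ℓ)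
        exact Continuous.measurable
          ((hc.comp (continuous_fst.sub continuous_snd)).enorm)
    _ ≤ ∫⁻ y, ENNReal.ofReal (2 ^ ℓ * A * s⁻¹ ^ j) *
          (‖ψ y‖ₑ * weight ℓ y + ENNReal.ofReal (s ^ ℓ) * ‖ψ y‖ₑ) := by
        refine lintegral_mono fun y => ?_
        dsimp only
        rw [lintegral_iteratedFDeriv_dilate_mul hs hf.contDiff hj]
        calc _ ≤ ‖ψ y‖ₑ * (ENNReal.ofReal (s⁻¹ ^ j) * ∫⁻ z, ‖iteratedFDeriv ℝ j f z‖ₑ *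
              (ENNReal.ofReal (2 ^ ℓ * (1 + ‖z‖) ^ ℓ) *
                (weight ℓ y + ENNReal.ofReal (s ^ ℓ)))) := by
              gcongr
              exact weight_smul_add_le hℓ hs _ _
          _ = _ := by
              simp only [← mul_assoc]
              rw [lintegral_mul_const' _ _ (by simp [weight]), hA', mul_comm (2 ^ ℓ * A),
                ENNReal.ofReal_mul (p := s⁻¹ ^ j) (by positivity)]
              ring
    _ = _ := by
        rw [lintegral_const_mul' _ _ ENNReal.ofReal_ne_top, lintegral_add_left',
          lintegral_const_mul' _ _ ENNReal.ofReal_ne_top, weightedNorm_eq]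
        exact hρ.mul (measurable_weight ℓ).aemeasurable

/-- Interpolation between `L^∞` and `L¹` through `|u|^q ≤ a^{q-1} |u|`. With `1/q = 0` the formula
also covers `q = ∞`. -/
theorem eLpNorm_le_of_bounds {N : ℕ} {F : Type*} [NormedAddCommGroup F] {u : Space N → F}
    (hu : AEStronglyMeasurable u) {a b : ℝ≥0∞} (ha : ∀ x, ‖u x‖ₑ ≤ a) (hb : ∫⁻ x, ‖u x‖ₑ ≤ b)
    {q : ℝ≥0∞} (hq : 1 ≤ q) :
    eLpNorm u q volume ≤ a ^ (1 - (q⁻¹).toReal) * b ^ (q⁻¹).toReal := by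
  rcases eq_or_ne q ∞ with rfl | hq'
  · simp only [ENNReal.inv_top, ENNReal.toReal_zero, sub_zero, ENNReal.rpow_one, ENNReal.rpow_zero,
      mul_one, eLpNorm_exponent_top]
    exact eLpNormEssSup_le_of_ae_enorm_bound (Eventually.of_forall ha)
  · have hq0 : q ≠ 0 := (zero_lt_one.trans_le hq).ne'
    set r := q.toReal with hr
    have hr1 : 1 ≤ r := by
      rw [hr, ← ENNReal.toReal_one]
      exact ENNReal.toReal_mono hq' hq
    have hr0 : 0 < r := by linarith
    rw [eLpNorm_eq_lintegral_rpow_enorm_toReal hq0 hq', ENNReal.toReal_inv, ← hr]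
    calc (∫⁻ x, ‖u x‖ₑ ^ r) ^ (1 / r) ≤ (a ^ (r - 1) * b) ^ (1 / r) := by
          gcongr
          calc ∫⁻ x, ‖u x‖ₑ ^ r ≤ ∫⁻ x, a ^ (r - 1) * ‖u x‖ₑ := by
                refine lintegral_mono fun x => ?_
                calc ‖u x‖ₑ ^ r = ‖u x‖ₑ ^ (r - 1) * ‖u x‖ₑ := by
                      conv_rhs => rw [← ENNReal.rpow_one ‖u x‖ₑ, ← ENNReal.rpow_mul, one_mul]
                      rw [← ENNReal.rpow_add_of_nonneg _ _ (by linarith) zero_le_one]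
                      ring_nf
                  _ ≤ _ := by
                      gcongr
                      exact ha x
            _ = a ^ (r - 1) * ∫⁻ x, ‖u x‖ₑ := lintegral_const_mul'' _ hu.enorm
            _ ≤ _ := by gcongr
      _ = _ := by
          rw [ENNReal.mul_rpow_of_nonneg _ _ (by positivity), ← ENNReal.rpow_mul]
          congr 2 <;> field_simp

theorem eLpNorm_iteratedFDeriv_conv_dilate_le {N n : ℕ} {p : ℝ} {f : Space N → ℝ}
    (hf : HasDecay n p f) (hp : N < p) {j : ℕ} (hj : j ≤ n) {q : ℝ≥0∞} (hq : 1 ≤ q) :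
    ∃ C : ℝ, 0 ≤ C ∧ ∀ s : ℝ, 0 < s → ∀ ψ : Space N → ℝ, Integrable ψ →
      eLpNorm (iteratedFDeriv ℝ j (conv (dilate s f) ψ)) q volume ≤
        ENNReal.ofReal (C * s ^ (-(N * (1 - (q⁻¹).toReal) + j))) * ∫⁻ x, ‖ψ x‖ₑ := by
  have hp0 : 0 ≤ p := by linarith [(N.cast_nonneg : (0 : ℝ) ≤ N)]
  obtain ⟨A, hA0, hA⟩ := hf.exists_norm_le hp0 hj
  obtain ⟨B, hB0, hB⟩ := weightedNorm_iteratedFDeriv_conv_dilate_le (ℓ := 0) hf le_rfl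
    (by simpa using hp) hj
  set θ := (q⁻¹).toReal
  have hθ0 : 0 ≤ θ := ENNReal.toReal_nonneg
  have hθ1 : θ ≤ 1 := by
    have : q⁻¹ ≤ 1 := ENNReal.inv_le_one.2 hq
    simpa only [ENNReal.toReal_one] using ENNReal.toReal_mono ENNReal.one_ne_top this
  refine ⟨A ^ (1 - θ) * (3 * B) ^ θ, by positivity, fun s hs ψ hψ => ?_⟩
  set m := ∫⁻ x, ‖ψ x‖ₑ
  have hfs := hf.dilate hs hp0
  have hc := (contDiff_conv hfs hp0 hψ).continuous_iteratedFDeriv (m := j) (by exact_mod_cast hj)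
  have h1 : ∀ x, ‖iteratedFDeriv ℝ j (conv (dilate s f) ψ) x‖ₑ ≤
      ENNReal.ofReal ((s ^ N)⁻¹ * (s⁻¹ ^ j * A)) * m := by
    intro x
    refine (enorm_iteratedFDeriv_conv_le hfs hp0 hψ hj x).trans ?_
    rw [← lintegral_const_mul' _ _ ENNReal.ofReal_ne_top]
    gcongr with y
    rw [← ofReal_norm, norm_iteratedFDeriv_dilate hs hf.contDiff hj]
    gcongr
    exact hA _
  have h2 : ∫⁻ x, ‖iteratedFDeriv ℝ j (conv (dilate s f) ψ) x‖ₑ ≤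
      ENNReal.ofReal (s⁻¹ ^ j * (3 * B)) * m := by
    refine (lintegral_enorm_le_weightedNorm 0 _).trans ((hB s hs ψ hψ).trans_eq ?_)
    -- For `ℓ = 0` the weight is identically `2`, so the weighted estimate contributes `2m + m`;
    -- this is the factor `3` in the constant.
    have : weightedNorm 0 ψ = 2 * m := by
      rw [weightedNorm_eq, ← lintegral_const_mul' _ _ (by simp)]
      congr 1; funext x
      rw [mul_comm]; congr 1
      simp only [weight, Real.rpow_zero]; norm_num
    rw [this, Real.rpow_zero, ENNReal.ofReal_one, show s⁻¹ ^ j * (3 * B) = B * s⁻¹ ^ j * 3 by ring,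
      ENNReal.ofReal_mul (q := 3) (by positivity)]
    simp only [ENNReal.ofReal_ofNat]
    ring
  refine (eLpNorm_le_of_bounds hc.aestronglyMeasurable h1 h2 hq).trans_eq ?_
  have h3 : 0 ≤ 1 - θ := by linarith
  rw [ENNReal.mul_rpow_of_nonneg _ _ h3, ENNReal.mul_rpow_of_nonneg _ _ hθ0,
    ENNReal.ofReal_rpow_of_nonneg (by positivity) h3,
    ENNReal.ofReal_rpow_of_nonneg (by positivity) hθ0, mul_mul_mul_comm,
    ← ENNReal.ofReal_mul (by positivity), ← ENNReal.rpow_add_of_nonneg _ _ h3 hθ0,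
    sub_add_cancel, ENNReal.rpow_one]
  congr 2
  have e1 : (s ^ N)⁻¹ = s ^ (-(N : ℝ)) := by rw [Real.rpow_neg hs.le, Real.rpow_natCast]
  have e2 : s⁻¹ ^ j = s ^ (-(j : ℝ)) := by rw [Real.rpow_neg hs.le, Real.rpow_natCast, inv_pow]
  rw [e1, e2, Real.mul_rpow (by positivity) (by positivity),
    Real.mul_rpow (by positivity) (by positivity), Real.mul_rpow (by positivity) (by positivity),
    ← Real.rpow_mul hs.le, ← Real.rpow_mul hs.le, ← Real.rpow_mul hs.le]
  have e3 : s ^ (-(N * (1 - θ) + j)) = s ^ (-(N : ℝ) * (1 - θ)) * (s ^ (-(j : ℝ) * (1 - θ)) *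
      s ^ (-(j : ℝ) * θ)) := by
    rw [← Real.rpow_add hs, ← Real.rpow_add hs]; ring_nf
  rw [e3]; ring

/-! ### The kernel as a dilated profile -/

namespace IsGeneralizedHeatKernel

variable {N γ : ℕ} {d L : ℝ} {G : Space N → ℝ → ℝ}

theorem hasDecay (hG : IsGeneralizedHeatKernel γ d L G) :
    HasDecay γ (N + L) (fun y => G y 1) := by
  refine ⟨?_, fun j hj => ?_⟩
  · have h1 : ContDiff ℝ γ (fun x : Space N => (x, (1 : ℝ))) := by fun_prop
    rw [← contDiffOn_univ] at h1 ⊢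
    exact hG.contDiffOn.comp h1 fun x _ => by simp
  · obtain ⟨C, hC⟩ := hG.decay j hj
    have h : ∀ x, (1 + ‖x‖) ^ ((N : ℝ) + L + j) * ‖iteratedFDeriv ℝ j (fun y => G y 1) x‖ ≤ C :=
      fun x => hC ⟨x, rfl⟩
    refine ⟨C, le_trans (by positivity) (h 0), fun x => ?_⟩
    rw [Real.rpow_neg (by positivity), ← div_eq_mul_inv, le_div_iff₀ (by positivity), mul_comm]
    exact h x

theorem eq_dilate (hG : IsGeneralizedHeatKernel γ d L G) {t : ℝ} (ht : 0 < t) :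
    (fun x => G x t) = dilate (t ^ (1 / d)) (fun y => G y 1) := by
  funext x
  rw [hG.scaling x t ht, dilate]
  congr 1
  rw [← Real.rpow_natCast, ← Real.rpow_mul ht.le, ← Real.rpow_neg ht.le]
  ring_nf

theorem evolution_eq (hG : IsGeneralizedHeatKernel γ d L G) {t : ℝ} (ht : 0 < t)
    (ψ : Space N → ℝ) :
    evolution G t ψ = conv (dilate (t ^ (1 / d)) (fun y => G y 1)) ψ := by
  rw [← hG.eq_dilate ht]; rfl

theorem eq_conv (hG : IsGeneralizedHeatKernel γ d L G) {s t : ℝ} (hs : 0 < s) (ht : 0 < t) :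
    (fun x => G x (s + t)) = conv (fun x => G x s) (fun x => G x t) := by
  funext x
  rw [hG.semigroup x t (s + t) ht (by linarith)]
  simp [conv]

end IsGeneralizedHeatKernel

theorem HasDecay.integrable {N n : ℕ} {p : ℝ} {f : Space N → ℝ} (hf : HasDecay n p f)
    (hp : N < p) : Integrable f := by
  have := hf.integrable_weight_mul (ℓ := 0) (Nat.zero_le _) (by simpa using hp)
  refine this.mono' hf.contDiff.continuous.aestronglyMeasurable (Eventually.of_forall fun x => ?_)
  simp

/-- Fubini applies because `g(y - z) ψ(z)` is integrable on the product and `f` is bounded. -/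
theorem conv_conv {N : ℕ} {f g ψ : Space N → ℝ} (hf : Continuous f) {C : ℝ}
    (hfb : ∀ x, |f x| ≤ C) (hg : Integrable g) (hψ : Integrable ψ) :
    conv f (conv g ψ) = conv (conv f g) ψ := by
  funext x
  have h1 : Integrable (fun z : Space N × Space N => g (z.1 - z.2) * ψ z.2)
      (volume.prod volume) := by
    simpa [mul_comm] using hψ.convolution_integrand (ContinuousLinearMap.mul ℝ ℝ) hg
  have h2 : Integrable (fun z : Space N × Space N => f (x - z.1) * (g (z.1 - z.2) * ψ z.2))
      (volume.prod volume) := by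
    refine h1.bdd_mul (c := C) ?_ (Eventually.of_forall fun z => hfb _)
    exact (hf.comp (continuous_const.sub continuous_fst)).aestronglyMeasurable
  calc conv f (conv g ψ) x = ∫ y, ∫ z, f (x - y) * (g (y - z) * ψ z) := by
        simp only [conv, integral_const_mul]
    _ = ∫ z, ∫ y, f (x - y) * (g (y - z) * ψ z) := integral_integral_swap h2
    _ = _ := by
        simp only [conv]
        congr 1; funext z
        rw [← integral_mul_const, ← integral_add_right_eq_self _ z]
        congr 1; funext y
        simp only [add_sub_cancel_right, sub_sub, add_comm z y]
        ring

theorem conv_dilate_eq {N : ℕ} {s : ℝ} (hs : 0 < s) (f g : Space N → ℝ) (x : Space N) :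
    conv (dilate s f) g x = ∫ z, f z * g (x - s • z) := by
  have h := Measure.integral_comp_inv_smul_of_nonneg (volume : Measure (Space N))
    (fun z => f z * g (x - s • z)) hs.le
  rw [conv_comm, conv]
  simp only [dilate, smul_inv_smul₀ hs.ne', finrank_euclideanSpace, Fintype.card_fin,
    smul_eq_mul] at h ⊢
  rw [← mul_right_inj' (pow_pos hs N).ne', ← h, ← integral_const_mul]
  congr 1; funext y
  field_simp

/-! ### The total mass of the profile -/

namespace IsGeneralizedHeatKernel

variable {N γ : ℕ} {d L : ℝ} {G : Space N → ℝ → ℝ}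

theorem natCast_lt (hG : IsGeneralizedHeatKernel γ d L G) : (N : ℝ) < N + L := by
  linarith [hG.L_pos]

theorem nonneg_exponent (hG : IsGeneralizedHeatKernel γ d L G) : (0 : ℝ) ≤ N + L := by
  have := hG.L_pos
  positivity

/-- Let `s → 0` in `G(x, s^d + 1) = ∫ G(z, 1) G(x - s z, 1) dz`, which is the semigroup law after
rescaling. The left side converges by continuity in time, the right side by dominated convergence.
-/
theorem eq_integral_mul (hG : IsGeneralizedHeatKernel γ d L G) (x : Space N) :
    G x 1 = (∫ z, G z 1) * G x 1 := by
  have hd := hG.d_pos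
  have hD := hG.hasDecay
  have hint := hD.integrable hG.natCast_lt
  obtain ⟨C, -, hC⟩ := hD.exists_norm_le hG.nonneg_exponent (Nat.zero_le _)
  have hC : ∀ x, |G x 1| ≤ C := fun x => by simpa using hC x
  have hcont : Continuous (fun y => G y 1) := hD.contDiff.continuous
  have e : ∀ s : ℝ, 0 < s → G x (s ^ d + 1) = ∫ z, G z 1 * G (x - s • z) 1 := by
    intro s hs
    have h := congrFun (hG.eq_conv (Real.rpow_pos_of_pos hs d) one_pos) x
    rw [hG.eq_dilate (Real.rpow_pos_of_pos hs d), ← Real.rpow_mul hs.le,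
      mul_one_div_cancel hd.ne', Real.rpow_one, conv_dilate_eq hs] at h
    exact h
  have l1 : Tendsto (fun s : ℝ => G x (s ^ d + 1)) (𝓝[>] 0) (𝓝 (G x 1)) := by
    have hc : ContinuousAt (fun q : Space N × ℝ => G q.1 q.2) (x, 1) :=
      hG.contDiffOn.continuousOn.continuousAt
        ((isOpen_univ.prod isOpen_Ioi).mem_nhds (by simp))
    have h2 : Tendsto (fun s : ℝ => (x, s ^ d + 1)) (𝓝[>] 0) (𝓝 (x, 1)) := by
      refine Tendsto.mono_left ?_ nhdsWithin_le_nhds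
      have : ContinuousAt (fun s : ℝ => (x, s ^ d + 1)) 0 :=
        continuousAt_const.prodMk ((Real.continuousAt_rpow_const 0 d (Or.inr hd.le)).add
          continuousAt_const)
      simpa [ContinuousAt, Real.zero_rpow hd.ne'] using this
    exact hc.tendsto.comp h2
  have l2 : Tendsto (fun s : ℝ => ∫ z, G z 1 * G (x - s • z) 1) (𝓝[>] 0)
      (𝓝 (∫ z, G z 1 * G x 1)) := by
    refine tendsto_integral_filter_of_dominated_convergence (fun z => |G z 1| * C)
      (Eventually.of_forall fun s => ?_) (Eventually.of_forall fun s => ?_) (hint.abs.mul_const C)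
      (Eventually.of_forall fun z => ?_)
    · exact (hcont.mul (hcont.comp (continuous_const.sub
        (continuous_id.const_smul s)))).aestronglyMeasurable
    · refine Eventually.of_forall fun z => ?_
      rw [norm_mul, Real.norm_eq_abs, Real.norm_eq_abs]
      gcongr
      exact hC _
    · refine Tendsto.const_mul _ (Tendsto.mono_left ?_ nhdsWithin_le_nhds)
      have : Continuous (fun s : ℝ => G (x - s • z) 1) :=
        hcont.comp (continuous_const.sub (continuous_id.smul continuous_const))
      simpa using this.tendsto 0
  rw [← integral_mul_const]
  refine tendsto_nhds_unique (l1.congr' ?_) l2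
  filter_upwards [self_mem_nhdsWithin] with s hs using e s hs

/-- The definition of the kernel does not normalize the mass. A point where the profile is nonzero
allows cancellation in the previous identity; otherwise scaling makes `G` vanish for all times, and
the estimates become trivial. -/
theorem integral_eq_one_or_eq_zero (hG : IsGeneralizedHeatKernel γ d L G) :
    (∫ z, G z 1) = 1 ∨ ∀ x t, 0 < t → G x t = 0 := by
  by_cases h : ∃ x, G x 1 ≠ 0
  · obtain ⟨x, hx⟩ := h
    exact Or.inl (mul_right_cancel₀ hx ((hG.eq_integral_mul x).symm.trans (one_mul _).symm))
  · push Not at h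
    refine Or.inr fun x t ht => ?_
    rw [hG.scaling x t ht, h, mul_zero]

end IsGeneralizedHeatKernel

/-! ### Moments of derivatives -/

theorem abs_monomial_le {N : ℕ} (α : Fin N → ℕ) (x : Space N) :
    |monomial α x| ≤ ‖x‖ ^ order α := by
  rw [monomial, Finset.abs_prod, order, ← Finset.prod_pow_eq_pow_sum]
  refine Finset.prod_le_prod (fun i _ => abs_nonneg _) fun i _ => ?_
  rw [abs_pow]
  gcongr
  exact PiLp.norm_apply_le x i

theorem continuous_monomial {N : ℕ} (α : Fin N → ℕ) : Continuous (monomial α) := by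
  unfold monomial
  fun_prop

theorem HasDecay.integrable_monomial_mul {N n : ℕ} {p : ℝ} {f : Space N → ℝ}
    (hf : HasDecay n p f) (α : Fin N → ℕ) (hp : N + order α < p) :
    Integrable (fun x => monomial α x * f x) := by
  refine (hf.integrable_weight_mul (ℓ := order α) (Nat.zero_le _) hp).mono'
    ((continuous_monomial α).mul hf.contDiff.continuous).aestronglyMeasurable
    (Eventually.of_forall fun x => ?_)
  rw [norm_mul, norm_iteratedFDeriv_zero, Real.rpow_natCast]
  gcongr
  refine (abs_monomial_le α x).trans ?_
  gcongr
  linarith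

theorem order_update_le {N : ℕ} (α : Fin N → ℕ) (i : Fin N) {b : ℕ} (hb : b ≤ α i) :
    order (Function.update α i b) ≤ order α := by
  refine Finset.sum_le_sum fun j _ => ?_
  rcases eq_or_ne j i with rfl | h <;> simp [*]

/-- Along the direction of `x_i` the monomial is a constant times a power of `x_i`. The truncated `α
i - 1` is harmless at `α i = 0`, where the coefficient vanishes. -/
theorem hasLineDerivAt_monomial {N : ℕ} (α : Fin N → ℕ) (i : Fin N) (x : Space N) :
    HasLineDerivAt ℝ (monomial α) (α i * monomial (Function.update α i (α i - 1)) x) x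
      (EuclideanSpace.single i (1 : ℝ)) := by
  have e : ∀ (β : Fin N → ℕ) (z : Space N),
      monomial β z = z i ^ β i * ∏ j ∈ Finset.univ.erase i, z j ^ β j := fun β z =>
    (Finset.mul_prod_erase _ (fun j => z j ^ β j) (Finset.mem_univ i)).symm
  have e1 : ∀ t : ℝ, monomial α (x + t • EuclideanSpace.single i (1 : ℝ)) =
      (x i + t) ^ α i * ∏ j ∈ Finset.univ.erase i, x j ^ α j := by
    intro t
    rw [e]
    congr 1
    · simp
    · refine Finset.prod_congr rfl fun j hj => ?_
      have : j ≠ i := Finset.ne_of_mem_erase hj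
      simp [this]
  have e2 : (α i : ℝ) * monomial (Function.update α i (α i - 1)) x =
      (α i * x i ^ (α i - 1)) * ∏ j ∈ Finset.univ.erase i, x j ^ α j := by
    rw [e, Function.update_self, ← mul_assoc]
    congr 1
    refine Finset.prod_congr rfl fun j hj => ?_
    rw [Function.update_of_ne (Finset.ne_of_mem_erase hj)]
  unfold HasLineDerivAt
  simp only [e1]
  rw [e2]
  refine HasDerivAt.mul_const ?_ _
  have := HasDerivAt.fun_pow ((hasDerivAt_id (0 : ℝ)).const_add (x i)) (α i)
  simpa using this

/-- Integration by parts. The decay makes all three products integrable, so no boundary term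
appears. -/
theorem integral_monomial_mul_partialDeriv {N n : ℕ} {p : ℝ} {f : Space N → ℝ}
    (hf : HasDecay (n + 1) p f) (α : Fin N → ℕ) (hp : N + order α < p) (i : Fin N) :
    ∫ x, monomial α x * partialDeriv i f x =
      -(α i * ∫ x, monomial (Function.update α i (α i - 1)) x * f x) := by
  have hd : Differentiable ℝ f := hf.contDiff.differentiable (by simp)
  have ho : (order (Function.update α i (α i - 1)) : ℝ) ≤ order α := by
    exact_mod_cast order_update_le α i (Nat.sub_le _ _)
  have h := integral_bilinear_hasLineDerivAt_right_eq_neg_left_of_integrable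
    (μ := (volume : Measure (Space N)))
    (f := monomial α) (g := f) (v := EuclideanSpace.single i (1 : ℝ))
    (f' := fun x => α i * monomial (Function.update α i (α i - 1)) x)
    (g' := partialDeriv i f) (B := ContinuousLinearMap.mul ℝ ℝ) ?_ ?_ ?_
    (fun x _ => hasLineDerivAt_monomial α i x)
    (fun x _ => (hd x).lineDifferentiableAt.hasLineDerivAt)
  · simp only [ContinuousLinearMap.mul_apply', mul_assoc, integral_const_mul] at h
    exact h
  · simp only [ContinuousLinearMap.mul_apply', mul_assoc]
    exact (hf.integrable_monomial_mul _ (by linarith)).const_mul _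
  · exact (hf.partialDeriv i).integrable_monomial_mul α (by linarith)
  · exact hf.integrable_monomial_mul α hp

theorem integral_monomial_mul_iterate_partialDeriv {N n : ℕ} (b : ℕ) {p : ℝ} {f : Space N → ℝ}
    (hf : HasDecay (n + b) p f) (α : Fin N → ℕ) (hp : N + order α < p) (i : Fin N) :
    ∫ x, monomial α x * (partialDeriv i)^[b] f x =
      (-1) ^ b * (α i).descFactorial b *
        ∫ x, monomial (Function.update α i (α i - b)) x * f x := by
  induction b generalizing n α with
  | zero => simp
  | succ b ih =>
    have hf' : HasDecay (n + 1 + b) p f := by convert hf using 1; omega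
    have ho : (order (Function.update α i (α i - 1)) : ℝ) ≤ order α := by
      exact_mod_cast order_update_le α i (Nat.sub_le _ _)
    have hb : (0 : ℝ) ≤ b := b.cast_nonneg
    rw [Function.iterate_succ_apply',
      integral_monomial_mul_partialDeriv (hf'.iterate_partialDeriv b i) α (by linarith) i,
      ih hf' _ (by linarith)]
    simp only [Function.update_self, Function.update_idem, Nat.sub_sub, add_comm 1 b]
    have hdf : (α i).descFactorial (b + 1) = α i * (α i - 1).descFactorial b := by
      rcases α i with _ | k
      · simp
      · rw [Nat.succ_descFactorial_succ, Nat.add_sub_cancel]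
    rw [hdf]
    push_cast
    ring

theorem integral_monomial_mul_multiDeriv {N n : ℕ} {p : ℝ} {f : Space N → ℝ} (α β : Fin N → ℕ)
    (hf : HasDecay (n + order β) p f) (hp : N + order α < p) :
    ∫ x, monomial α x * multiDeriv β f x =
      (∏ i, (-1) ^ β i * ((α i).descFactorial (β i) : ℝ)) * ∫ x, monomial (α - β) x * f x := by
  -- Integrating by parts in coordinate `i` alters the `i`-th exponent, so `α` must vary in the
  -- induction. Absence of repetitions ensures that the coordinates still to be treated keep their
  -- original exponents.
  have key : ∀ (l : List (Fin N)) (n : ℕ) (α : Fin N → ℕ), l.Nodup →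
      HasDecay (n + (l.map β).sum) p f → N + order α < p →
      ∫ x, monomial α x * l.foldr (fun i h => (partialDeriv i)^[β i] h) f x =
        (l.map fun i => (-1) ^ β i * ((α i).descFactorial (β i) : ℝ)).prod *
          ∫ x, monomial (fun i => if i ∈ l then α i - β i else α i) x * f x := by
    intro l
    induction l with
    | nil => simp
    | cons i l ih =>
      intro n α hl h hp
      obtain ⟨hi, hl⟩ := List.nodup_cons.1 hl
      have h' : HasDecay (n + β i + (l.map β).sum) p f := by
        convert h using 1; simp only [List.map_cons, List.sum_cons]; omega
      have ho : (order (Function.update α i (α i - β i)) : ℝ) ≤ order α := by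
        exact_mod_cast order_update_le α i (Nat.sub_le _ _)
      have hs : (0 : ℝ) ≤ ((l.map β).sum : ℕ) := Nat.cast_nonneg _
      simp only [List.foldr_cons]
      rw [integral_monomial_mul_iterate_partialDeriv _ (h'.foldr_partialDeriv β l) α
        (by linarith) i, ih _ _ hl h' (by linarith), List.map_cons, List.prod_cons, mul_assoc,
        mul_assoc, mul_assoc]
      have e1 : (l.map fun j => (-1) ^ β j *
          ((Function.update α i (α i - β i) j).descFactorial (β j) : ℝ)) =
          l.map fun j => (-1) ^ β j * ((α j).descFactorial (β j) : ℝ) := by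
        refine List.map_congr_left fun j hj => ?_
        rw [Function.update_of_ne (fun h : j = i => hi (h ▸ hj))]
      have e2 : (fun j => if j ∈ l then Function.update α i (α i - β i) j - β j
          else Function.update α i (α i - β i) j) =
          fun j => if j ∈ i :: l then α j - β j else α j := by
        funext j
        rcases eq_or_ne j i with rfl | hj
        · simp [hi]
        · simp [hj]
      rw [e1, e2]
  have := key (List.finRange N) n α (List.nodup_finRange N) (by rwa [sum_map_finRange]) hp
  rw [multiDeriv, this, ← List.ofFn_eq_map, List.prod_ofFn]
  simp only [List.mem_finRange, if_true]
  rfl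

/-! ### Subtracting the profiles `g_α` -/

theorem HasDecay.const_mul {N n : ℕ} {p : ℝ} {f : Space N → ℝ} (hf : HasDecay n p f) (c : ℝ) :
    HasDecay n p (fun x => c * f x) := by
  refine ⟨contDiff_const.mul hf.contDiff, fun j hj => ?_⟩
  obtain ⟨C, hC, h⟩ := hf.bound j hj
  refine ⟨|c| * C, by positivity, fun x => ?_⟩
  have : iteratedFDeriv ℝ j (fun x => c * f x) x = c • iteratedFDeriv ℝ j f x :=
    iteratedFDeriv_const_smul_apply' (a := c)
      (hf.contDiff.of_le (by exact_mod_cast hj)).contDiffAt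
  rw [this, norm_smul, mul_assoc]
  gcongr
  · rfl
  · exact h x

theorem HasDecay.memWeightedL1 {N n : ℕ} {p K : ℝ} {f : Space N → ℝ} (hf : HasDecay n p f)
    (hK : 0 ≤ K) (hp : N + K < p) : MemWeightedL1 K f := by
  refine ⟨hf.contDiff.continuous.aestronglyMeasurable, ?_⟩
  have hI := (hf.integrable_weight_mul (Nat.zero_le _) hp).const_mul 2
  refine lt_of_le_of_lt (lintegral_mono fun x => ?_) hI.2
  dsimp only
  rw [← ofReal_norm, ← ofReal_norm, ← ENNReal.ofReal_mul (norm_nonneg _),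
    norm_iteratedFDeriv_zero,
    Real.norm_of_nonneg (show 0 ≤ 2 * ((1 + ‖x‖) ^ K * ‖f x‖) by positivity)]
  refine ENNReal.ofReal_le_ofReal ?_
  have h1 : 1 ≤ (1 + ‖x‖) ^ K := Real.one_le_rpow (by linarith [norm_nonneg x]) hK
  have h2 : ‖x‖ ^ K ≤ (1 + ‖x‖) ^ K := by gcongr; linarith
  nlinarith [norm_nonneg (f x)]

theorem enorm_monomial_le_weight {N : ℕ} {K : ℝ} {α : Fin N → ℕ} (hα : (order α : ℝ) ≤ K)
    (x : Space N) : ‖monomial α x‖ₑ ≤ weight K x := by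
  rw [← ofReal_norm, weight]
  refine ENNReal.ofReal_le_ofReal ((abs_monomial_le α x).trans ?_)
  rw [← Real.rpow_natCast]
  exact rpow_le_one_add_rpow (norm_nonneg x) (Nat.cast_nonneg _) hα

theorem lintegral_enorm_monomial_mul_le {N : ℕ} {K : ℝ} {α : Fin N → ℕ} (hα : (order α : ℝ) ≤ K)
    (f : Space N → ℝ) : ∫⁻ x, ‖monomial α x * f x‖ₑ ≤ weightedNorm K f := by
  rw [weightedNorm_eq]
  refine lintegral_mono fun x => ?_
  rw [enorm_mul, mul_comm]
  gcongr
  exact enorm_monomial_le_weight hα x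

theorem MemWeightedL1.integrable_monomial_mul {N : ℕ} {K : ℝ} {f : Space N → ℝ}
    (hf : MemWeightedL1 K f) {α : Fin N → ℕ} (hα : (order α : ℝ) ≤ K) :
    Integrable (fun x => monomial α x * f x) :=
  ⟨(continuous_monomial α).aestronglyMeasurable.mul hf.1,
    (lintegral_enorm_monomial_mul_le hα f).trans_lt hf.2⟩

theorem weightedNorm_sub_sum_le {N : ℕ} {ι : Type*} (s : Finset ι) {K : ℝ} {φ : Space N → ℝ}
    (hφ : AEStronglyMeasurable φ) (c : ι → ℝ) {g : ι → Space N → ℝ}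
    (hg : ∀ i ∈ s, AEStronglyMeasurable (g i)) :
    weightedNorm K (fun x => φ x - ∑ i ∈ s, c i * g i x) ≤
      weightedNorm K φ + ∑ i ∈ s, ‖c i‖ₑ * weightedNorm K (g i) := by
  simp only [weightedNorm_eq]
  have e : ∀ i ∈ s, ‖c i‖ₑ * ∫⁻ x, ‖g i x‖ₑ * weight K x =
      ∫⁻ x, ‖c i‖ₑ * (‖g i x‖ₑ * weight K x) := fun i hi =>
    (lintegral_const_mul' _ _ enorm_ne_top).symm
  rw [Finset.sum_congr rfl e, ← lintegral_finsetSum', ← lintegral_add_left']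
  · refine lintegral_mono fun x => ?_
    dsimp only
    calc ‖φ x - ∑ i ∈ s, c i * g i x‖ₑ * weight K x
        ≤ (‖φ x‖ₑ + ∑ i ∈ s, ‖c i‖ₑ * ‖g i x‖ₑ) * weight K x := by
          gcongr
          refine enorm_sub_le.trans ?_
          gcongr
          refine (enorm_sum_le _ _).trans_eq ?_
          simp only [enorm_mul]
      _ = _ := by rw [add_mul, Finset.sum_mul]; simp only [mul_assoc]
  · exact hφ.enorm.mul (measurable_weight K).aemeasurable
  · intro i hi
    exact ((hg i hi).enorm.mul (measurable_weight K).aemeasurable).const_mul _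

/-- Induction on the order through the recursion. The integrals `∫ x^α g_β(x, 0) dx` enter only as
real numbers independent of `φ`, so nothing is required of `G`. -/
theorem exists_enorm_modMoment_le {N : ℕ} {K : ℝ} (G : Space N → ℝ → ℝ) (α : Fin N → ℕ)
    (hα : (order α : ℝ) ≤ K) :
    ∃ C : ℝ, 0 ≤ C ∧ ∀ φ : Space N → ℝ,
      ‖modMoment G φ 0 α‖ₑ ≤ ENNReal.ofReal C * weightedNorm K φ := by
  induction hn : order α using Nat.strong_induction_on generalizing α with
  | _ n ih =>
    have h : ∀ β : {β : Fin N → ℕ // β ∈ Finset.Iio α}, ∃ C : ℝ, 0 ≤ C ∧ ∀ φ : Space N → ℝ,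
        ‖modMoment G φ 0 β.1‖ₑ ≤ ENNReal.ofReal C * weightedNorm K φ := by
      rintro ⟨β, hβ⟩
      have hlt := order_lt_order (Finset.mem_Iio.1 hβ)
      have : (order β : ℝ) ≤ order α := by exact_mod_cast hlt.le
      exact ih _ (hn ▸ hlt) β (this.trans hα) rfl
    choose C hC0 hC using h
    set a : {β : Fin N → ℕ // β ∈ Finset.Iio α} → ℝ := fun β =>
      ‖∫ x, monomial α x * gKernel G β.1 x 0‖
    refine ⟨1 + ∑ β, C β * a β, ?_, fun φ => ?_⟩
    · have := Finset.sum_nonneg fun β (_ : β ∈ Finset.univ) =>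
        mul_nonneg (hC0 β) (norm_nonneg (∫ x, monomial α x * gKernel G β.1 x 0))
      linarith
    · rw [modMoment]
      refine enorm_sub_le.trans ?_
      rw [ENNReal.ofReal_add zero_le_one (Finset.sum_nonneg fun β _ =>
        mul_nonneg (hC0 β) (norm_nonneg _)), add_mul, ENNReal.ofReal_one, one_mul,
        ENNReal.ofReal_sum_of_nonneg fun β _ => mul_nonneg (hC0 β) (norm_nonneg _),
        Finset.sum_mul]
      refine add_le_add ((enorm_integral_le_lintegral_enorm _).trans
        (lintegral_enorm_monomial_mul_le hα φ)) ((enorm_sum_le _ _).trans ?_)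
      refine Finset.sum_le_sum fun β _ => ?_
      rw [enorm_mul, ENNReal.ofReal_mul (hC0 β), ofReal_norm]
      calc _ ≤ ENNReal.ofReal (C β) * weightedNorm K φ *
            ‖∫ x, monomial α x * gKernel G β.1 x 0‖ₑ := by gcongr; exact hC β φ
        _ = _ := by ring

/-- `φ - ∑_{|α| ≤ K} M_α(φ, 0) g_α(·, 0)`. -/
def corrected {N : ℕ} (G : Space N → ℝ → ℝ) (K : ℝ) (φ : Space N → ℝ) (x : Space N) : ℝ :=
  φ x - ∑ α ∈ multiIndices N K, modMoment G φ 0 α * gKernel G α x 0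

/-! ### The corrected datum: moments, size and evolution -/

namespace IsGeneralizedHeatKernel

variable {N γ : ℕ} {d L K : ℝ} {G : Space N → ℝ → ℝ}

theorem hasDecay_multiDeriv (hG : IsGeneralizedHeatKernel γ d L G) (hKγ : ⌊K⌋₊ + 1 ≤ γ)
    {α : Fin N → ℕ} (hα : (order α : ℝ) ≤ K) :
    HasDecay (1 + order α) (N + L) (fun y => G y 1) :=
  hG.hasDecay.mono (by have := Nat.le_floor hα; omega) le_rfl

theorem hasDecay_gKernel (hG : IsGeneralizedHeatKernel γ d L G) (hKγ : ⌊K⌋₊ + 1 ≤ γ)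
    {α : Fin N → ℕ} (hα : (order α : ℝ) ≤ K) :
    HasDecay 1 (N + L) (fun x => gKernel G α x 0) := by
  have h := ((hG.hasDecay_multiDeriv hKγ hα).multiDeriv α).const_mul
    ((-1) ^ order α / (multiFactorial α : ℝ))
  have := h.mono le_rfl (q := N + L) (by linarith [(order α).cast_nonneg (α := ℝ)])
  simpa only [gKernel, zero_add] using this

theorem integral_monomial_mul_gKernel (hG : IsGeneralizedHeatKernel γ d L G)
    (hKγ : ⌊K⌋₊ + 1 ≤ γ) (hKL : K < L) {α β : Fin N → ℕ} (hα : (order α : ℝ) ≤ K)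
    (hβ : (order β : ℝ) ≤ K) :
    ∫ x, monomial α x * gKernel G β x 0 = (-1) ^ order β / (multiFactorial β : ℝ) *
      ((∏ i, (-1) ^ β i * ((α i).descFactorial (β i) : ℝ)) *
        ∫ x, monomial (α - β) x * G x 1) := by
  rw [← integral_monomial_mul_multiDeriv α β (hG.hasDecay_multiDeriv hKγ hβ) (by linarith),
    ← integral_const_mul]
  simp only [gKernel, zero_add]
  congr 1; funext x; ring

/-- If `β i > α i`, differentiating `x^α` that often in `x_i` gives zero; the corresponding falling
factorial vanishes. -/
theorem integral_monomial_mul_gKernel_eq_zero (hG : IsGeneralizedHeatKernel γ d L G)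
    (hKγ : ⌊K⌋₊ + 1 ≤ γ) (hKL : K < L) {α β : Fin N → ℕ} (hα : (order α : ℝ) ≤ K)
    (hβ : (order β : ℝ) ≤ K) (h : ¬ β ≤ α) : ∫ x, monomial α x * gKernel G β x 0 = 0 := by
  rw [hG.integral_monomial_mul_gKernel hKγ hKL hα hβ]
  obtain ⟨i, hi⟩ : ∃ i, α i < β i := by simpa [Pi.le_def] using h
  rw [Finset.prod_eq_zero (Finset.mem_univ i), zero_mul, mul_zero]
  rw [Nat.descFactorial_of_lt hi, Nat.cast_zero, mul_zero]

/-- The normalization `(-1)^{|α|} / α!` cancels the sign and the factorial produced by integration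
by parts, leaving the total mass. -/
theorem integral_monomial_mul_gKernel_self (hG : IsGeneralizedHeatKernel γ d L G)
    (hKγ : ⌊K⌋₊ + 1 ≤ γ) (hKL : K < L) (hm : ∫ x, G x 1 = 1) {α : Fin N → ℕ}
    (hα : (order α : ℝ) ≤ K) : ∫ x, monomial α x * gKernel G α x 0 = 1 := by
  rw [hG.integral_monomial_mul_gKernel hKγ hKL hα hα]
  have h0 : ∀ x : Space N, monomial 0 x = 1 := fun x => by simp [monomial]
  have h1 : (multiFactorial α : ℝ) ≠ 0 := by
    rw [multiFactorial]
    exact_mod_cast Finset.prod_ne_zero_iff.2 fun i _ => Nat.factorial_ne_zero _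
  simp only [tsub_self, h0, one_mul, hm, mul_one, Nat.descFactorial_self]
  rw [Finset.prod_mul_distrib, Finset.prod_pow_eq_pow_sum]
  have h2 : ∏ i, ((α i).factorial : ℝ) = multiFactorial α := by
    rw [multiFactorial]; push_cast; rfl
  have h3 : ((-1 : ℝ) ^ order α) * (-1) ^ order α = 1 := by
    rw [← mul_pow]; simp
  rw [h2, ← order, ← mul_assoc, div_mul_eq_mul_div, div_mul_cancel₀ _ h1, h3]

theorem memWeightedL1_gKernel (hG : IsGeneralizedHeatKernel γ d L G)
    (hKγ : ⌊K⌋₊ + 1 ≤ γ) (hK0 : 0 ≤ K) (hKL : K < L) {α : Fin N → ℕ} (hα : (order α : ℝ) ≤ K) :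
    MemWeightedL1 K (fun x => gKernel G α x 0) :=
  (hG.hasDecay_gKernel hKγ hα).memWeightedL1 hK0 (by linarith)

theorem aestronglyMeasurable_corrected (hG : IsGeneralizedHeatKernel γ d L G)
    (hKγ : ⌊K⌋₊ + 1 ≤ γ) (hK0 : 0 ≤ K) (hKL : K < L) {φ : Space N → ℝ}
    (hφ : AEStronglyMeasurable φ) : AEStronglyMeasurable (corrected G K φ) := by
  refine hφ.sub ?_
  refine Finset.aestronglyMeasurable_fun_sum _ fun α hα => ?_
  exact (hG.memWeightedL1_gKernel hKγ hK0 hKL ((mem_multiIndices hK0 α).1 hα)).1.const_mul _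

theorem exists_weightedNorm_corrected_le (hG : IsGeneralizedHeatKernel γ d L G)
    (hKγ : ⌊K⌋₊ + 1 ≤ γ) (hK0 : 0 ≤ K) (hKL : K < L) :
    ∃ C : ℝ, 0 ≤ C ∧ ∀ φ : Space N → ℝ, MemWeightedL1 K φ →
      weightedNorm K (corrected G K φ) ≤ ENNReal.ofReal C * weightedNorm K φ := by
  have h : ∀ α : {α // α ∈ multiIndices N K}, ∃ C : ℝ, 0 ≤ C ∧ ∀ φ : Space N → ℝ,
      ‖modMoment G φ 0 α.1‖ₑ ≤ ENNReal.ofReal C * weightedNorm K φ := fun α =>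
    exists_enorm_modMoment_le G α.1 ((mem_multiIndices hK0 α.1).1 α.2)
  choose C hC0 hC using h
  have hg : ∀ α ∈ multiIndices N K, MemWeightedL1 K (fun x => gKernel G α x 0) := fun α hα =>
    hG.memWeightedL1_gKernel hKγ hK0 hKL ((mem_multiIndices hK0 α).1 hα)
  set w : (Fin N → ℕ) → ℝ := fun α => (weightedNorm K (fun x => gKernel G α x 0)).toReal
  have hw : ∀ α : {α // α ∈ multiIndices N K}, 0 ≤ C α * w α.1 := fun α =>
    mul_nonneg (hC0 α) ENNReal.toReal_nonneg
  refine ⟨1 + ∑ α, C α * w α.1,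
    add_nonneg zero_le_one (Finset.sum_nonneg fun α _ => hw α), fun φ hφ => ?_⟩
  refine (weightedNorm_sub_sum_le _ hφ.1 _ fun α hα => (hg α hα).1).trans ?_
  rw [ENNReal.ofReal_add zero_le_one (Finset.sum_nonneg fun α _ => hw α), add_mul,
    ENNReal.ofReal_one, one_mul, ENNReal.ofReal_sum_of_nonneg fun α _ => hw α, Finset.sum_mul,
    ← Finset.sum_coe_sort]
  refine add_le_add le_rfl (Finset.sum_le_sum fun α _ => ?_)
  rw [ENNReal.ofReal_mul (hC0 α), ENNReal.ofReal_toReal (hg α.1 α.2).2.ne]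
  calc _ ≤ ENNReal.ofReal (C α) * weightedNorm K φ *
        weightedNorm K (fun x => gKernel G α.1 x 0) := by gcongr; exact hC α φ
    _ = _ := by ring

theorem memWeightedL1_corrected (hG : IsGeneralizedHeatKernel γ d L G)
    (hKγ : ⌊K⌋₊ + 1 ≤ γ) (hK0 : 0 ≤ K) (hKL : K < L) {φ : Space N → ℝ}
    (hφ : MemWeightedL1 K φ) : MemWeightedL1 K (corrected G K φ) := by
  obtain ⟨C, -, hC⟩ := hG.exists_weightedNorm_corrected_le hKγ hK0 hKL
  exact ⟨hG.aestronglyMeasurable_corrected hKγ hK0 hKL hφ.1,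
    (hC φ hφ).trans_lt (ENNReal.mul_lt_top ENNReal.ofReal_lt_top hφ.2)⟩

/-- Only `β ≤ α` contribute to the moment of the sum. The term `β = α` equals `M_α(φ, 0)`, and the
recursion says precisely that it cancels everything else. -/
theorem integral_monomial_mul_corrected (hG : IsGeneralizedHeatKernel γ d L G)
    (hKγ : ⌊K⌋₊ + 1 ≤ γ) (hK0 : 0 ≤ K) (hKL : K < L) (hm : ∫ x, G x 1 = 1) {φ : Space N → ℝ}
    (hφ : MemWeightedL1 K φ) {α : Fin N → ℕ} (hα : (order α : ℝ) ≤ K) :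
    ∫ x, monomial α x * corrected G K φ x = 0 := by
  have hI : ∀ β ∈ multiIndices N K,
      Integrable (fun x => modMoment G φ 0 β * (monomial α x * gKernel G β x 0)) := fun β hβ =>
    ((hG.memWeightedL1_gKernel hKγ hK0 hKL
      ((mem_multiIndices hK0 β).1 hβ)).integrable_monomial_mul hα).const_mul _
  have e : ∀ x, monomial α x * corrected G K φ x = monomial α x * φ x -
      ∑ β ∈ multiIndices N K, modMoment G φ 0 β * (monomial α x * gKernel G β x 0) := by
    intro x
    rw [corrected, mul_sub, Finset.mul_sum]
    congr 1
    refine Finset.sum_congr rfl fun β _ => ?_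
    ring
  simp only [e]
  rw [integral_sub (hφ.integrable_monomial_mul hα) (integrable_finsetSum _ hI),
    integral_finsetSum _ hI]
  simp only [integral_const_mul]
  have hsub : Finset.Iic α ⊆ multiIndices N K := fun β hβ => by
    rw [mem_multiIndices hK0]
    have : order β ≤ order α := Finset.sum_le_sum fun i _ => Finset.mem_Iic.1 hβ i
    exact le_trans (by exact_mod_cast this) hα
  rw [← Finset.sum_subset hsub fun β hβ hβ' => by
    rw [hG.integral_monomial_mul_gKernel_eq_zero hKγ hKL hα ((mem_multiIndices hK0 β).1 hβ)
      (by simpa using hβ'), mul_zero], ← Finset.Iio_insert, Finset.sum_insert (by simp),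
    hG.integral_monomial_mul_gKernel_self hKγ hKL hm hα, modMoment_eq G φ 0 α]
  ring

theorem hasDecay_dilate (hG : IsGeneralizedHeatKernel γ d L G) {s : ℝ} (hs : 0 < s) :
    HasDecay γ (N + L) (dilate s (fun y => G y 1)) :=
  hG.hasDecay.dilate hs hG.nonneg_exponent

theorem abs_dilate_le (hG : IsGeneralizedHeatKernel γ d L G) {s : ℝ} (hs : 0 < s) :
    ∃ C, ∀ x, |dilate s (fun y => G y 1) x| ≤ C := by
  obtain ⟨C, -, hC⟩ := (hG.hasDecay_dilate hs).exists_norm_le hG.nonneg_exponent (Nat.zero_le _)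
  exact ⟨C, fun x => by simpa using hC x⟩

/-- Write `G(·, t + 1) = G(·, 1) * G(·, t)` and let `∂^α` fall on the first factor. -/
theorem gKernel_eq_evolution (hG : IsGeneralizedHeatKernel γ d L G) (hKγ : ⌊K⌋₊ + 1 ≤ γ)
    {α : Fin N → ℕ} (hα : (order α : ℝ) ≤ K) {t : ℝ} (ht : 0 < t) (x : Space N) :
    gKernel G α x t = evolution G t (fun y => gKernel G α y 0) x := by
  have hint : Integrable (fun x => G x t) := by
    rw [hG.eq_dilate ht]
    exact (hG.hasDecay_dilate (Real.rpow_pos_of_pos ht _)).integrable hG.natCast_lt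
  have h1 : (fun y => G y (t + 1)) = conv (fun y => G y 1) (fun y => G y t) := by
    rw [← hG.eq_conv one_pos ht, add_comm]
  rw [gKernel, h1, multiDeriv_conv α (hG.hasDecay_multiDeriv hKγ hα) hG.nonneg_exponent hint,
    conv_comm, conv, evolution, ← integral_const_mul]
  congr 1; funext y
  rw [gKernel, zero_add]
  ring

theorem remainder_eq (hG : IsGeneralizedHeatKernel γ d L G)
    (hKγ : ⌊K⌋₊ + 1 ≤ γ) (hK0 : 0 ≤ K) (hKL : K < L) {φ : Space N → ℝ}
    (hφ : MemWeightedL1 K φ) {t : ℝ} (ht : 0 < t) :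
    remainder G K φ t = conv (dilate (t ^ (1 / d)) (fun y => G y 1)) (corrected G K φ) := by
  funext x
  have hs := Real.rpow_pos_of_pos ht (1 / d)
  obtain ⟨C, hC⟩ := hG.abs_dilate_le hs
  have hc := (hG.hasDecay_dilate hs).contDiff.continuous
  have hI : ∀ α ∈ multiIndices N K, Integrable (fun y => modMoment G φ 0 α *
      (dilate (t ^ (1 / d)) (fun y => G y 1) (x - y) * gKernel G α y 0)) := fun α hα =>
    (integrable_comp_sub_mul hc hC (hG.memWeightedL1_gKernel hKγ hK0 hKL
      ((mem_multiIndices hK0 α).1 hα)).integrable x).const_mul _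
  rw [remainder, Finset.sum_congr rfl fun α hα => by
    rw [hG.gKernel_eq_evolution hKγ ((mem_multiIndices hK0 α).1 hα) ht, hG.evolution_eq ht, conv,
      ← integral_const_mul], hG.evolution_eq ht, conv, conv, ← integral_finsetSum _ hI,
    ← integral_sub (integrable_comp_sub_mul hc hC hφ.integrable x) (integrable_finsetSum _ hI)]
  congr 1; funext y
  rw [corrected, mul_sub, Finset.mul_sum]
  congr 1
  refine Finset.sum_congr rfl fun α _ => ?_
  ring

theorem conv_dilate_half (hG : IsGeneralizedHeatKernel γ d L G) {t : ℝ} (ht : 0 < t)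
    {ψ : Space N → ℝ} (hψ : Integrable ψ) :
    conv (dilate (t ^ (1 / d)) (fun y => G y 1)) ψ =
      conv (dilate ((t / 2) ^ (1 / d)) (fun y => G y 1))
        (conv (dilate ((t / 2) ^ (1 / d)) (fun y => G y 1)) ψ) := by
  have ht2 : 0 < t / 2 := by positivity
  have hs := Real.rpow_pos_of_pos ht2 (1 / d)
  obtain ⟨C, hC⟩ := hG.abs_dilate_le hs
  have hD := hG.hasDecay_dilate hs
  rw [conv_conv hD.contDiff.continuous hC (hD.integrable hG.natCast_lt) hψ,
    ← hG.eq_dilate ht2, ← hG.eq_conv ht2 ht2, ← hG.eq_dilate ht]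
  simp

end IsGeneralizedHeatKernel

/-! ### Vanishing moments -/

theorem prod_comp_eq_monomial {N i : ℕ} (r : Fin i → Fin N) (y : Space N) :
    ∏ l, y (r l) = monomial (fun j => (Finset.univ.filter fun l => r l = j).card) y := by
  rw [monomial, ← Finset.prod_fiberwise Finset.univ r]
  refine Finset.prod_congr rfl fun j _ => ?_
  rw [Finset.prod_congr rfl fun l hl => by rw [(Finset.mem_filter.1 hl).2], Finset.prod_const]

theorem order_card_fiber {N i : ℕ} (r : Fin i → Fin N) :
    order (fun j => (Finset.univ.filter fun l => r l = j).card) = i := by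
  rw [order, ← Finset.card_eq_sum_card_fiberwise fun _ _ => Finset.mem_coe.2 (Finset.mem_univ _),
    Finset.card_univ, Fintype.card_fin]

/-- Links coordinate-free Taylor terms to monomial moments. A choice `r` of one coordinate per slot
contributes the monomial counting how often each coordinate is chosen, which has order `i`. -/
theorem multilinear_diagonal_eq {N i : ℕ} (m : (Space N) [×i]→L[ℝ] ℝ) (y : Space N) :
    m (fun _ => y) = ∑ r : Fin i → Fin N,
      monomial (fun j => (Finset.univ.filter fun l => r l = j).card) y *
        m (fun l => EuclideanSpace.single (r l) (1 : ℝ)) := by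
  have hy : y = ∑ j, y j • EuclideanSpace.single j (1 : ℝ) := by
    ext a; simp [Pi.single_apply]
  have h1 : m (fun _ => y) = m (fun _ => ∑ j, y j • EuclideanSpace.single j (1 : ℝ)) := by
    rw [← hy]
  rw [h1, ContinuousMultilinearMap.map_sum]
  refine Finset.sum_congr rfl fun r _ => ?_
  rw [← prod_comp_eq_monomial, ContinuousMultilinearMap.map_smul_univ, smul_eq_mul]

theorem integrable_multilinear_diagonal_mul {N i : ℕ} {K : ℝ} {ψ : Space N → ℝ}
    (hψ : MemWeightedL1 K ψ) (hi : (i : ℝ) ≤ K) (m : (Space N) [×i]→L[ℝ] ℝ) :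
    Integrable (fun y => m (fun _ => y) * ψ y) := by
  simp only [multilinear_diagonal_eq, Finset.sum_mul]
  refine integrable_finsetSum _ fun r _ => ?_
  have := (hψ.integrable_monomial_mul (K := K) ((order_card_fiber r).symm ▸ hi)).const_mul
    (m (fun l => EuclideanSpace.single (r l) (1 : ℝ)))
  refine this.congr (Eventually.of_forall fun y => ?_)
  dsimp only
  ring

theorem integral_multilinear_diagonal_mul {N i : ℕ} {K : ℝ} {ψ : Space N → ℝ}
    (hψ : MemWeightedL1 K ψ) (hi : (i : ℝ) ≤ K) (m : (Space N) [×i]→L[ℝ] ℝ)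
    (hmom : ∀ α : Fin N → ℕ, (order α : ℝ) ≤ K → ∫ y, monomial α y * ψ y = 0) :
    ∫ y, m (fun _ => y) * ψ y = 0 := by
  have e : ∀ y, m (fun _ => y) * ψ y = ∑ r : Fin i → Fin N,
      m (fun l => EuclideanSpace.single (r l) (1 : ℝ)) *
        (monomial (fun j => (Finset.univ.filter fun l => r l = j).card) y * ψ y) := by
    intro y
    rw [multilinear_diagonal_eq, Finset.sum_mul]
    refine Finset.sum_congr rfl fun r _ => ?_
    ring
  simp only [e]
  rw [integral_finsetSum _ fun r _ =>
    (hψ.integrable_monomial_mul ((order_card_fiber r).symm ▸ hi)).const_mul _]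
  refine Finset.sum_eq_zero fun r _ => ?_
  rw [integral_const_mul, hmom _ ((order_card_fiber r).symm ▸ hi), mul_zero]

/-! ### The Taylor remainder of the profile -/

/-- `f(z - η)` minus its Taylor polynomial of degree `k` at `z`. -/
def taylorRemainder {N : ℕ} (k : ℕ) (f : Space N → ℝ) (z η : Space N) : ℝ :=
  f (z - η) - ∑ i ∈ Finset.range (k + 1),
    ((i.factorial : ℝ)⁻¹ * iteratedFDeriv ℝ i f z (fun _ => -η))

theorem continuous_taylorRemainder {N n k : ℕ} {f : Space N → ℝ} (hf : ContDiff ℝ n f)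
    (hk : k ≤ n) : Continuous (Function.uncurry (taylorRemainder k f)) := by
  unfold taylorRemainder Function.uncurry
  refine (hf.continuous.comp (continuous_fst.sub continuous_snd)).sub ?_
  refine continuous_finsetSum _ fun i hi => continuous_const.mul ?_
  have h1 : Continuous (iteratedFDeriv ℝ i f) := hf.continuous_iteratedFDeriv
    (by have := Finset.mem_range.1 hi; exact_mod_cast (by omega : i ≤ n))
  have h2 : Continuous fun q : Space N × Space N => (fun _ : Fin i => -q.2) := by fun_prop
  exact (h1.comp continuous_fst).eval h2

/-- Integral form of the remainder. For `‖η‖ ≤ 1` the weight `1 + |·|` on the segment from `z` to `z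
- η` is at least half its value at `z`, so decay along the segment becomes decay in `z`. -/
theorem HasDecay.abs_taylorRemainder_le {N n k : ℕ} {p : ℝ} {f : Space N → ℝ}
    (hf : HasDecay n p f) (hk : k + 1 ≤ n) (hp : 0 ≤ p) :
    ∃ C : ℝ, 0 ≤ C ∧ ∀ z η : Space N, ‖η‖ ≤ 1 →
      ‖taylorRemainder k f z η‖ ≤ C * ‖η‖ ^ (k + 1) * (1 + ‖z‖) ^ (-p) := by
  obtain ⟨C, hC0, hC⟩ := hf.bound (k + 1) hk
  refine ⟨(k.factorial : ℝ)⁻¹ * (C * 2 ^ p), by positivity, fun z η hη => ?_⟩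
  have hT := map_add_eq_sum_add_integral_iteratedFDeriv (f := f) (x := z) (y := -η) (n := k)
    fun t _ => (hf.contDiff.of_le (by exact_mod_cast hk)).contDiffAt
  have e : taylorRemainder k f z η = (k.factorial : ℝ)⁻¹ •
      ∫ t in (0 : ℝ)..1, (1 - t) ^ k • iteratedFDeriv ℝ (k + 1) f (z + t • -η) (fun _ ↦ -η) := by
    rw [taylorRemainder, sub_eq_add_neg z η, hT]
    simp
  rw [e, norm_smul, Real.norm_of_nonneg (by positivity), mul_assoc, mul_assoc]
  refine mul_le_mul_of_nonneg_left ?_ (by positivity)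
  have := intervalIntegral.norm_integral_le_of_norm_le_const (a := (0 : ℝ)) (b := 1)
    (f := fun t => (1 - t) ^ k • iteratedFDeriv ℝ (k + 1) f (z + t • -η) (fun _ ↦ -η))
    (C := C * 2 ^ p * (‖η‖ ^ (k + 1) * (1 + ‖z‖) ^ (-p))) ?_
  · simpa using this
  intro t ht
  rw [Set.uIoc_of_le zero_le_one] at ht
  have ht1 : |1 - t| ≤ 1 := by rw [_root_.abs_le]; constructor <;> linarith [ht.1, ht.2]
  have hw : 1 + ‖z‖ ≤ 2 * (1 + ‖z + t • -η‖) := by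
    have h1 : ‖z‖ ≤ ‖z + t • -η‖ + ‖t • η‖ := by
      have := norm_sub_le (z + t • -η) (-(t • η))
      simpa using this
    have h2 : ‖t • η‖ ≤ 1 := by
      rw [norm_smul, Real.norm_of_nonneg ht.1.le]
      nlinarith [norm_nonneg η, ht.1, ht.2]
    linarith [norm_nonneg (z + t • -η)]
  have hd : ‖iteratedFDeriv ℝ (k + 1) f (z + t • -η)‖ ≤ C * (2 ^ p * (1 + ‖z‖) ^ (-p)) := by
    refine (hC _).trans (mul_le_mul_of_nonneg_left ?_ hC0)
    -- The extra decay of order `k + 1` gained by differentiation is not needed and is dropped.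
    calc (1 + ‖z + t • -η‖) ^ (-(p + ↑(k + 1))) ≤ (1 + ‖z + t • -η‖) ^ (-p) := by
          have : (0 : ℝ) ≤ ((k + 1 : ℕ) : ℝ) := Nat.cast_nonneg _
          refine Real.rpow_le_rpow_of_exponent_le ?_ (by linarith)
          linarith [norm_nonneg (z + t • -η)]
      _ ≤ _ := by
          rw [Real.rpow_neg (by positivity), Real.rpow_neg (by positivity), ← div_eq_mul_inv,
            le_div_iff₀ (by positivity), inv_mul_le_iff₀ (by positivity), mul_comm,
            ← Real.mul_rpow (by positivity) (by positivity)]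
          gcongr
  calc ‖(1 - t) ^ k • iteratedFDeriv ℝ (k + 1) f (z + t • -η) (fun _ ↦ -η)‖
      ≤ 1 * (‖iteratedFDeriv ℝ (k + 1) f (z + t • -η)‖ * ‖η‖ ^ (k + 1)) := by
        rw [norm_smul, norm_pow, Real.norm_eq_abs]
        refine mul_le_mul (pow_le_one₀ (abs_nonneg _) ht1) ?_ (norm_nonneg _) zero_le_one
        refine (ContinuousMultilinearMap.le_opNorm _ _).trans_eq ?_
        simp
    _ ≤ 1 * (C * (2 ^ p * (1 + ‖z‖) ^ (-p)) * ‖η‖ ^ (k + 1)) := by gcongr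
    _ = _ := by ring

/-- The weighted `L¹` norm in `z` of the Taylor remainder at displacement `η`. -/
def remainderMass {N : ℕ} (k : ℕ) (ℓ : ℝ) (f : Space N → ℝ) (η : Space N) : ℝ≥0∞ :=
  ∫⁻ z, ‖taylorRemainder k f z η‖ₑ * ENNReal.ofReal ((1 + ‖z‖) ^ ℓ)

theorem measurable_remainderMass {N n k : ℕ} {f : Space N → ℝ} (hf : ContDiff ℝ n f)
    (hk : k ≤ n) (ℓ : ℝ) : Measurable (remainderMass k ℓ f) := by
  have h : Measurable (Function.uncurry fun (η z : Space N) =>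
      ‖taylorRemainder k f z η‖ₑ * ENNReal.ofReal ((1 + ‖z‖) ^ ℓ)) := by
    have h1 : Measurable fun q : Space N × Space N => ‖taylorRemainder k f q.2 q.1‖ₑ :=
      ((continuous_taylorRemainder hf hk).comp
        (continuous_snd.prodMk continuous_fst)).enorm.measurable
    exact h1.mul (by fun_prop)
  exact h.lintegral_prod_right

theorem HasDecay.lintegral_weight {N n : ℕ} {p ℓ : ℝ} {f : Space N → ℝ} (hf : HasDecay n p f)
    {j : ℕ} (hj : j ≤ n) (hp : N + ℓ < p) :
    ∫⁻ z, ‖iteratedFDeriv ℝ j f z‖ₑ * ENNReal.ofReal ((1 + ‖z‖) ^ ℓ) =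
      ENNReal.ofReal (∫ z, (1 + ‖z‖) ^ ℓ * ‖iteratedFDeriv ℝ j f z‖) := by
  rw [ofReal_integral_eq_lintegral_ofReal (hf.integrable_weight_mul hj hp)
    (Eventually.of_forall fun z => by positivity)]
  congr 1; funext z
  rw [← ofReal_norm, ← ENNReal.ofReal_mul (norm_nonneg _), mul_comm]

theorem HasDecay.remainderMass_le_of_norm_le_one {N n k : ℕ} {p ℓ : ℝ} {f : Space N → ℝ}
    (hf : HasDecay n p f) (hk : k + 1 ≤ n) (hℓ : 0 ≤ ℓ) (hp : N + ℓ < p) :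
    ∃ C : ℝ, 0 ≤ C ∧ ∀ η : Space N, ‖η‖ ≤ 1 →
      remainderMass k ℓ f η ≤ ENNReal.ofReal (C * ‖η‖ ^ (k + 1)) := by
  have hN : (0 : ℝ) ≤ N := N.cast_nonneg
  obtain ⟨C, hC0, hC⟩ := hf.abs_taylorRemainder_le hk (by linarith)
  have hI := integrable_one_add_norm_rpow (N := N) (r := p - ℓ) (by linarith)
  have hA0 : 0 ≤ ∫ z : Space N, (1 + ‖z‖) ^ (-(p - ℓ)) :=
    integral_nonneg fun z => by positivity
  refine ⟨C * ∫ z : Space N, (1 + ‖z‖) ^ (-(p - ℓ)), by positivity, fun η hη => ?_⟩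
  calc remainderMass k ℓ f η
      ≤ ∫⁻ z, ENNReal.ofReal (C * ‖η‖ ^ (k + 1) * (1 + ‖z‖) ^ (-(p - ℓ))) := by
        refine lintegral_mono fun z => ?_
        dsimp only
        rw [← ofReal_norm, ← ENNReal.ofReal_mul (norm_nonneg _)]
        refine ENNReal.ofReal_le_ofReal ?_
        calc _ ≤ C * ‖η‖ ^ (k + 1) * (1 + ‖z‖) ^ (-p) * (1 + ‖z‖) ^ ℓ := by
              gcongr; exact hC z η hη
          _ = _ := by
              rw [mul_assoc, ← Real.rpow_add (by positivity)]; ring_nf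
    _ = _ := by
        rw [← ofReal_integral_eq_lintegral_ofReal (hI.const_mul _)
          (Eventually.of_forall fun z => by positivity), integral_const_mul]
        congr 1; ring

theorem one_add_norm_add_le {N : ℕ} (z η : Space N) :
    1 + ‖z + η‖ ≤ (1 + ‖z‖) * (1 + ‖η‖) := by
  nlinarith [norm_add_le z η, norm_nonneg z, norm_nonneg η]

/-- For large displacements there is no cancellation to exploit and each term is bounded separately.
Shifting the weight costs `|η|^ℓ`, the Taylor terms cost `|η|^i` with `i ≤ k`, and all these powers
are at most `|η|^K`. -/
theorem HasDecay.remainderMass_le_of_one_le_norm {N n k : ℕ} {p ℓ K : ℝ} {f : Space N → ℝ}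
    (hf : HasDecay n p f) (hk : k + 1 ≤ n) (hkK : (k : ℝ) ≤ K) (hℓ : 0 ≤ ℓ) (hℓK : ℓ ≤ K)
    (hp : N + ℓ < p) :
    ∃ C : ℝ, 0 ≤ C ∧ ∀ η : Space N, 1 ≤ ‖η‖ →
      remainderMass k ℓ f η ≤ ENNReal.ofReal (C * ‖η‖ ^ K) := by
  set A : ℕ → ℝ := fun i => ∫ z, (1 + ‖z‖) ^ ℓ * ‖iteratedFDeriv ℝ i f z‖
  have hA : ∀ i, 0 ≤ A i := fun i => integral_nonneg fun z => by positivity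
  have hS : 0 ≤ ∑ i ∈ Finset.range (k + 1), A i := Finset.sum_nonneg fun i _ => hA i
  refine ⟨A 0 * 2 ^ ℓ + ∑ i ∈ Finset.range (k + 1), A i,
    add_nonneg (mul_nonneg (hA 0) (by positivity)) hS, fun η hη => ?_⟩
  have hη0 : 0 ≤ ‖η‖ := norm_nonneg η
  have hcont : Continuous f := hf.contDiff.continuous
  have h1 : ∫⁻ z, ‖f (z - η)‖ₑ * ENNReal.ofReal ((1 + ‖z‖) ^ ℓ) ≤
      ENNReal.ofReal (A 0 * 2 ^ ℓ * ‖η‖ ^ K) := by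
    rw [← lintegral_add_right_eq_self _ η]
    calc _ ≤ ∫⁻ z, ‖iteratedFDeriv ℝ 0 f z‖ₑ * ENNReal.ofReal ((1 + ‖z‖) ^ ℓ) *
          ENNReal.ofReal (2 ^ ℓ * ‖η‖ ^ K) := by
          refine lintegral_mono fun z => ?_
          dsimp only
          rw [add_sub_cancel_right, mul_assoc, ← ENNReal.ofReal_mul (by positivity),
            ← ofReal_norm (iteratedFDeriv ℝ 0 f z), norm_iteratedFDeriv_zero, ofReal_norm]
          gcongr
          calc (1 + ‖z + η‖) ^ ℓ ≤ ((1 + ‖z‖) * (2 * ‖η‖)) ^ ℓ := by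
                gcongr
                refine (one_add_norm_add_le z η).trans ?_
                gcongr
                linarith
            _ = (1 + ‖z‖) ^ ℓ * (2 ^ ℓ * ‖η‖ ^ ℓ) := by
                rw [Real.mul_rpow (by positivity) (by positivity),
                  Real.mul_rpow (by positivity) (by positivity)]
            _ ≤ _ := by gcongr
      _ = _ := by
          rw [lintegral_mul_const' _ _ ENNReal.ofReal_ne_top, hf.lintegral_weight (Nat.zero_le _) hp,
            ← ENNReal.ofReal_mul (hA 0), mul_assoc]
  have h2 : ∀ i ∈ Finset.range (k + 1), ∫⁻ z, ‖(i.factorial : ℝ)⁻¹ *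
      iteratedFDeriv ℝ i f z (fun _ => -η)‖ₑ * ENNReal.ofReal ((1 + ‖z‖) ^ ℓ) ≤
        ENNReal.ofReal (A i * ‖η‖ ^ K) := by
    intro i hi
    have hik : i ≤ k := by have := Finset.mem_range.1 hi; omega
    calc _ ≤ ∫⁻ z, ENNReal.ofReal (‖η‖ ^ K) *
          (‖iteratedFDeriv ℝ i f z‖ₑ * ENNReal.ofReal ((1 + ‖z‖) ^ ℓ)) := by
          refine lintegral_mono fun z => ?_
          dsimp only
          rw [← mul_assoc]
          gcongr
          rw [← ofReal_norm, ← ofReal_norm, ← ENNReal.ofReal_mul (by positivity)]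
          refine ENNReal.ofReal_le_ofReal ?_
          rw [norm_mul, Real.norm_of_nonneg (by positivity)]
          have hf1 : (i.factorial : ℝ)⁻¹ ≤ 1 :=
            inv_le_one_of_one_le₀ (by exact_mod_cast Nat.one_le_iff_ne_zero.2 i.factorial_ne_zero)
          have hop : ‖iteratedFDeriv ℝ i f z (fun _ => -η)‖ ≤
              ‖iteratedFDeriv ℝ i f z‖ * ‖η‖ ^ i :=
            (ContinuousMultilinearMap.le_opNorm _ _).trans_eq (by simp)
          have hpow : ‖η‖ ^ i ≤ ‖η‖ ^ K := by
            rw [← Real.rpow_natCast]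
            exact Real.rpow_le_rpow_of_exponent_le hη
              (le_trans (by exact_mod_cast hik) hkK)
          calc _ ≤ 1 * (‖iteratedFDeriv ℝ i f z‖ * ‖η‖ ^ K) := by
                refine mul_le_mul hf1 (hop.trans ?_) (norm_nonneg _) zero_le_one
                gcongr
            _ = _ := by ring
      _ = _ := by
          rw [lintegral_const_mul' _ _ ENNReal.ofReal_ne_top,
            hf.lintegral_weight (by omega) hp, ← ENNReal.ofReal_mul (by positivity), mul_comm]
  calc remainderMass k ℓ f η
      ≤ ∫⁻ z, (‖f (z - η)‖ₑ * ENNReal.ofReal ((1 + ‖z‖) ^ ℓ) +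
          ∑ i ∈ Finset.range (k + 1), ‖(i.factorial : ℝ)⁻¹ *
            iteratedFDeriv ℝ i f z (fun _ => -η)‖ₑ * ENNReal.ofReal ((1 + ‖z‖) ^ ℓ)) := by
        refine lintegral_mono fun z => ?_
        dsimp only
        rw [← Finset.sum_mul, ← add_mul]
        gcongr
        exact enorm_sub_le.trans (add_le_add le_rfl (enorm_sum_le _ _))
    _ ≤ ENNReal.ofReal (A 0 * 2 ^ ℓ * ‖η‖ ^ K) +
          ∑ i ∈ Finset.range (k + 1), ENNReal.ofReal (A i * ‖η‖ ^ K) := by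
        have hm1 : Measurable fun z : Space N =>
            ‖f (z - η)‖ₑ * ENNReal.ofReal ((1 + ‖z‖) ^ ℓ) :=
          ((hcont.comp (continuous_sub_right η)).enorm.measurable).mul (by fun_prop)
        have hm2 : ∀ i ∈ Finset.range (k + 1), Measurable fun z : Space N =>
            ‖(i.factorial : ℝ)⁻¹ * iteratedFDeriv ℝ i f z (fun _ => -η)‖ₑ *
              ENNReal.ofReal ((1 + ‖z‖) ^ ℓ) := by
          intro i hi
          have hc : Continuous (iteratedFDeriv ℝ i f) := hf.contDiff.continuous_iteratedFDeriv
            (by have := Finset.mem_range.1 hi; exact_mod_cast (by omega : i ≤ n))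
          have hc' : Continuous fun z => iteratedFDeriv ℝ i f z (fun _ => -η) :=
            hc.eval continuous_const
          exact (hc'.const_smul (i.factorial : ℝ)⁻¹).enorm.measurable.mul (by fun_prop)
        rw [lintegral_add_left hm1, lintegral_finsetSum _ hm2]
        exact add_le_add h1 (Finset.sum_le_sum h2)
    _ = _ := by
        rw [← ENNReal.ofReal_sum_of_nonneg fun i _ => mul_nonneg (hA i) (by positivity),
          ← ENNReal.ofReal_add (mul_nonneg (mul_nonneg (hA 0) (by positivity)) (by positivity))
            (Finset.sum_nonneg fun i _ => mul_nonneg (hA i) (by positivity)),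
          ← Finset.sum_mul, ← add_mul]

/-- The global bound gives the decay rate and an integrable majorant; the sharper power for small
`η` gives the improvement in the limit. -/
theorem HasDecay.exists_remainderMass_le {N n k : ℕ} {p ℓ K : ℝ} {f : Space N → ℝ}
    (hf : HasDecay n p f) (hk : k + 1 ≤ n) (hkK : (k : ℝ) ≤ K) (hKk : K ≤ k + 1) (hℓ : 0 ≤ ℓ)
    (hℓK : ℓ ≤ K) (hp : N + ℓ < p) :
    ∃ C : ℝ, 0 ≤ C ∧ ∀ η : Space N, remainderMass k ℓ f η ≤ ENNReal.ofReal (C * ‖η‖ ^ K) ∧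
      (‖η‖ ≤ 1 → remainderMass k ℓ f η ≤ ENNReal.ofReal (C * ‖η‖ ^ (k + 1))) := by
  obtain ⟨C, hC0, hC⟩ := hf.remainderMass_le_of_norm_le_one hk hℓ hp
  obtain ⟨C', hC'0, hC'⟩ := hf.remainderMass_le_of_one_le_norm hk hkK hℓ hℓK hp
  have hsmall : ∀ η : Space N, ‖η‖ ≤ 1 →
      remainderMass k ℓ f η ≤ ENNReal.ofReal ((C + C') * ‖η‖ ^ (k + 1)) := fun η hη => by
    refine (hC η hη).trans (ENNReal.ofReal_le_ofReal ?_)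
    gcongr
    linarith
  refine ⟨C + C', by positivity, fun η => ⟨?_, hsmall η⟩⟩
  rcases le_total ‖η‖ 1 with h | h
  · refine (hsmall η h).trans (ENNReal.ofReal_le_ofReal ?_)
    gcongr
    rw [← Real.rpow_natCast]
    have hK0 : 0 ≤ K := hℓ.trans hℓK
    -- The comparison of real powers requires a positive base, so `η = 0` is treated apart.
    rcases (norm_nonneg η).eq_or_lt with h0 | h0
    · rw [← h0, Real.zero_rpow (by positivity)]
      positivity
    · exact Real.rpow_le_rpow_of_exponent_ge h0 h (by push_cast; exact hKk)
  · refine (hC' η h).trans (ENNReal.ofReal_le_ofReal ?_)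
    gcongr
    linarith

/-! ### Decay of the evolution of functions with vanishing moments -/

/-- At fixed `x`, the Taylor polynomial at `x / s` is a polynomial in `y` of degree at most `k ≤ K`,
so its integral against `ψ` vanishes. -/
theorem conv_dilate_eq_integral_taylorRemainder {N n k : ℕ} {p s K : ℝ} {f ψ : Space N → ℝ}
    (hf : HasDecay n p f) (hp : 0 ≤ p) (hkK : (k : ℝ) ≤ K) (hs : 0 < s)
    (hψ : MemWeightedL1 K ψ)
    (hmom : ∀ α : Fin N → ℕ, (order α : ℝ) ≤ K → ∫ y, monomial α y * ψ y = 0) (x : Space N) :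
    conv (dilate s f) ψ x =
      ∫ y, (s ^ N)⁻¹ * taylorRemainder k f (s⁻¹ • x) (s⁻¹ • y) * ψ y := by
  obtain ⟨C, -, hC⟩ := (hf.dilate hs hp).exists_norm_le hp (Nat.zero_le _)
  have hint := integrable_comp_sub_mul (hf.dilate hs hp).contDiff.continuous
    (fun x => by simpa using hC x) hψ.integrable x
  have hiK : ∀ i ∈ Finset.range (k + 1), (i : ℝ) ≤ K := fun i hi => by
    have : i ≤ k := by have := Finset.mem_range.1 hi; omega
    exact le_trans (by exact_mod_cast this) hkK
  set z := s⁻¹ • x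
  set c : ℕ → ℝ := fun i => (s ^ N)⁻¹ * ((i.factorial : ℝ)⁻¹ * (-s⁻¹) ^ i)
  have e : ∀ y, (s ^ N)⁻¹ * taylorRemainder k f z (s⁻¹ • y) * ψ y =
      dilate s f (x - y) * ψ y - ∑ i ∈ Finset.range (k + 1),
        c i * (iteratedFDeriv ℝ i f z (fun _ => y) * ψ y) := by
    intro y
    have h1 : ∀ i, iteratedFDeriv ℝ i f z (fun _ => -(s⁻¹ • y)) =
        (-s⁻¹) ^ i * iteratedFDeriv ℝ i f z (fun _ => y) := by
      intro i
      have := (iteratedFDeriv ℝ i f z).map_smul_univ (fun _ => -s⁻¹) (fun _ => y)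
      simpa using this
    rw [taylorRemainder, dilate, smul_sub, mul_sub, sub_mul, Finset.mul_sum, Finset.sum_mul]
    congr 1
    refine Finset.sum_congr rfl fun i _ => ?_
    rw [h1]
    ring
  have hI : ∀ i ∈ Finset.range (k + 1), Integrable
      (fun y => c i * (iteratedFDeriv ℝ i f z (fun _ => y) * ψ y)) := fun i hi =>
    (integrable_multilinear_diagonal_mul hψ (hiK i hi) _).const_mul _
  simp only [e]
  rw [integral_sub hint (integrable_finsetSum _ hI), integral_finsetSum _ hI,
    Finset.sum_eq_zero fun i hi => ?_, sub_zero, conv]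
  rw [integral_const_mul, integral_multilinear_diagonal_mul hψ (hiK i hi) _ hmom, mul_zero]

theorem weight_smul_le {N : ℕ} {ℓ s : ℝ} (hℓ : 0 ≤ ℓ) (hs : 0 < s) (z : Space N) :
    weight ℓ (s • z) ≤ ENNReal.ofReal ((1 + ‖z‖) ^ ℓ) * ENNReal.ofReal (1 + s ^ ℓ) := by
  rw [weight, ← ENNReal.ofReal_mul (by positivity), norm_smul, Real.norm_of_nonneg hs.le,
    Real.mul_rpow hs.le (norm_nonneg z)]
  refine ENNReal.ofReal_le_ofReal ?_
  have h1 : ‖z‖ ^ ℓ ≤ (1 + ‖z‖) ^ ℓ := by gcongr; linarith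
  have h2 : 1 ≤ (1 + ‖z‖) ^ ℓ := Real.one_le_rpow (by linarith [norm_nonneg z]) hℓ
  nlinarith [Real.rpow_nonneg hs.le ℓ]

theorem weightedNorm_conv_dilate_le_remainderMass {N n k : ℕ} {p s ℓ K : ℝ} {f ψ : Space N → ℝ}
    (hf : HasDecay n p f) (hk : k ≤ n) (hp : 0 ≤ p) (hkK : (k : ℝ) ≤ K) (hℓ : 0 ≤ ℓ) (hs : 0 < s)
    (hψ : MemWeightedL1 K ψ)
    (hmom : ∀ α : Fin N → ℕ, (order α : ℝ) ≤ K → ∫ y, monomial α y * ψ y = 0) :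
    weightedNorm ℓ (conv (dilate s f) ψ) ≤
      ∫⁻ y, ‖ψ y‖ₑ * (ENNReal.ofReal (1 + s ^ ℓ) * remainderMass k ℓ f (s⁻¹ • y)) := by
  have hR := continuous_taylorRemainder hf.contDiff hk
  calc weightedNorm ℓ (conv (dilate s f) ψ)
      ≤ ∫⁻ x, (∫⁻ y, ‖(s ^ N)⁻¹ * taylorRemainder k f (s⁻¹ • x) (s⁻¹ • y)‖ₑ * ‖ψ y‖ₑ) *
          weight ℓ x := by
        rw [weightedNorm_eq]
        gcongr with x
        rw [conv_dilate_eq_integral_taylorRemainder hf hp hkK hs hψ hmom]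
        refine (enorm_integral_le_lintegral_enorm _).trans_eq ?_
        simp only [enorm_mul]
    _ = ∫⁻ y, ‖ψ y‖ₑ * ∫⁻ x, ‖(s ^ N)⁻¹ * taylorRemainder k f (s⁻¹ • x) (s⁻¹ • y)‖ₑ *
          weight ℓ x := by
        refine lintegral_lintegral_mul_weight
          (k := fun x y => ‖(s ^ N)⁻¹ * taylorRemainder k f (s⁻¹ • x) (s⁻¹ • y)‖ₑ) ?_
          hψ.1.enorm (measurable_weight ℓ)
        have : Continuous fun q : Space N × Space N =>
            (s ^ N)⁻¹ * taylorRemainder k f (s⁻¹ • q.1) (s⁻¹ • q.2) :=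
          continuous_const.mul (hR.comp (by fun_prop :
            Continuous fun q : Space N × Space N => (s⁻¹ • q.1, s⁻¹ • q.2)))
        exact this.enorm.measurable
    _ ≤ _ := by
        refine lintegral_mono fun y => ?_
        dsimp only
        gcongr
        have e : ∀ x, ‖(s ^ N)⁻¹ * taylorRemainder k f (s⁻¹ • x) (s⁻¹ • y)‖ₑ * weight ℓ x =
            ENNReal.ofReal (s ^ N)⁻¹ * (‖taylorRemainder k f (s⁻¹ • x) (s⁻¹ • y)‖ₑ *
              weight ℓ (s • (s⁻¹ • x))) := by
          intro x
          rw [smul_inv_smul₀ hs.ne', enorm_mul, Real.enorm_of_nonneg (by positivity), mul_assoc]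
        simp only [e]
        rw [lintegral_const_mul' _ _ ENNReal.ofReal_ne_top, lintegral_comp_inv_smul hs
          (fun z => ‖taylorRemainder k f z (s⁻¹ • y)‖ₑ * weight ℓ (s • z)), ← mul_assoc,
          ← ENNReal.ofReal_mul (by positivity), inv_mul_cancel₀ (by positivity),
          ENNReal.ofReal_one, one_mul, remainderMass,
          ← lintegral_const_mul' _ _ ENNReal.ofReal_ne_top]
        refine lintegral_mono fun z => ?_
        dsimp only
        calc _ ≤ ‖taylorRemainder k f z (s⁻¹ • y)‖ₑ *
              (ENNReal.ofReal ((1 + ‖z‖) ^ ℓ) * ENNReal.ofReal (1 + s ^ ℓ)) := by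
              gcongr; exact weight_smul_le hℓ hs z
          _ = _ := by ring

theorem rpow_sub_le_of_one_le {s ℓ K : ℝ} (hs : 1 ≤ s) (hℓ : 0 ≤ ℓ) :
    (1 + s ^ ℓ) * s⁻¹ ^ K ≤ 2 * s ^ (ℓ - K) := by
  have hs0 : 0 < s := by linarith
  have h1 : 1 ≤ s ^ ℓ := Real.one_le_rpow hs hℓ
  rw [Real.inv_rpow hs0.le, Real.rpow_sub hs0, div_eq_mul_inv, ← mul_assoc]
  gcongr
  linarith

/-- For `s ≤ 1` no decay is required and the direct estimate suffices. For `s ≥ 1` the bound `O(|y /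
s|^K)` on the remainder mass supplies the factor `s^{-K}`. -/
theorem HasDecay.exists_weightedNorm_conv_dilate_le {N n : ℕ} {p ℓ K : ℝ} {f : Space N → ℝ}
    (hf : HasDecay n p f) (hK : ⌊K⌋₊ + 1 ≤ n) (hℓ : 0 ≤ ℓ) (hℓK : ℓ ≤ K) (hp : N + K < p) :
    ∃ C : ℝ, 0 ≤ C ∧ ∀ s : ℝ, 0 < s → ∀ ψ : Space N → ℝ, MemWeightedL1 K ψ →
      (∀ α : Fin N → ℕ, (order α : ℝ) ≤ K → ∫ y, monomial α y * ψ y = 0) →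
      weightedNorm ℓ (conv (GenHeat.dilate s f) ψ) ≤
        ENNReal.ofReal (C * (1 + s) ^ (ℓ - K)) * weightedNorm K ψ := by
  have hN : (0 : ℝ) ≤ N := N.cast_nonneg
  have hK0 : 0 ≤ K := hℓ.trans hℓK
  have hkK : (⌊K⌋₊ : ℝ) ≤ K := Nat.floor_le hK0
  have hKk : K ≤ (⌊K⌋₊ : ℝ) + 1 := (Nat.lt_floor_add_one K).le
  obtain ⟨A, hA0, hA⟩ := weightedNorm_iteratedFDeriv_conv_dilate_le (ℓ := ℓ) hf hℓ
    (by linarith) (Nat.zero_le _)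
  obtain ⟨B, hB0, hB⟩ := hf.exists_remainderMass_le hK hkK hKk hℓ hℓK (by linarith)
  -- `A * 3` serves `s ≤ 1` and `B * 2` serves `s ≥ 1`. The power of two is the price of replacing
  -- `1`, respectively `s ^ (ℓ - K)`, by `(1 + s) ^ (ℓ - K)`.
  refine ⟨(A * 3 + B * 2) * 2 ^ (K - ℓ), by positivity, fun s hs ψ hψ hmom => ?_⟩
  rcases le_total s 1 with h | h
  · have h1 : weightedNorm ℓ (conv (GenHeat.dilate s f) ψ) ≤
        weightedNorm ℓ (iteratedFDeriv ℝ 0 (conv (GenHeat.dilate s f) ψ)) := by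
      simp only [weightedNorm_eq]
      refine lintegral_mono fun x => ?_
      dsimp only
      rw [← ofReal_norm (iteratedFDeriv ℝ 0 _ x), norm_iteratedFDeriv_zero, ofReal_norm]
    refine h1.trans ((hA s hs ψ hψ.integrable).trans ?_)
    have h2 : ENNReal.ofReal (s ^ ℓ) * ∫⁻ x, ‖ψ x‖ₑ ≤ weightedNorm K ψ := by
      calc _ ≤ 1 * weightedNorm K ψ := by
            gcongr
            · exact ENNReal.ofReal_le_one.2 (Real.rpow_le_one hs.le h hℓ)
            · exact lintegral_enorm_le_weightedNorm K ψ
        _ = _ := one_mul _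
    calc _ ≤ ENNReal.ofReal (A * s⁻¹ ^ 0) * (2 * weightedNorm K ψ + weightedNorm K ψ) := by
          gcongr
          exact weightedNorm_le hℓ hℓK ψ
      _ = ENNReal.ofReal (A * 3) * weightedNorm K ψ := by
          rw [pow_zero, mul_one, ENNReal.ofReal_mul hA0, ENNReal.ofReal_ofNat]
          ring
      _ ≤ _ := by
          gcongr ENNReal.ofReal ?_ * _
          have h3 : 1 ≤ (2 : ℝ) ^ (K - ℓ) * (1 + s) ^ (ℓ - K) := by
            calc (1 : ℝ) = 2 ^ (K - ℓ) * 2 ^ (ℓ - K) := by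
                  rw [← Real.rpow_add two_pos]; simp
              _ ≤ _ := by
                  gcongr 2 ^ (K - ℓ) * ?_
                  exact Real.rpow_le_rpow_of_nonpos (by linarith) (by linarith) (by linarith)
          calc A * 3 ≤ (A * 3 + B * 2) * 1 := by linarith
            _ ≤ _ := by rw [mul_assoc]; gcongr
  · refine (weightedNorm_conv_dilate_le_remainderMass hf (by omega) (by linarith) hkK hℓ hs hψ
      hmom).trans ?_
    rw [weightedNorm_eq, ← lintegral_const_mul' _ _ ENNReal.ofReal_ne_top]
    refine lintegral_mono fun y => ?_
    dsimp only
    rw [mul_left_comm (ENNReal.ofReal _)]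
    gcongr ‖ψ y‖ₑ * ?_
    calc _ ≤ ENNReal.ofReal (1 + s ^ ℓ) * ENNReal.ofReal (B * ‖s⁻¹ • y‖ ^ K) := by
          gcongr; exact (hB _).1
      _ ≤ ENNReal.ofReal ((A * 3 + B * 2) * 2 ^ (K - ℓ) * (1 + s) ^ (ℓ - K) * (1 + ‖y‖ ^ K)) := by
          rw [← ENNReal.ofReal_mul (by positivity)]
          refine ENNReal.ofReal_le_ofReal ?_
          rw [norm_smul, Real.norm_of_nonneg (by positivity),
            Real.mul_rpow (by positivity) (by positivity)]
          have h3 : s ^ (ℓ - K) ≤ 2 ^ (K - ℓ) * (1 + s) ^ (ℓ - K) := by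
            calc s ^ (ℓ - K) ≤ ((1 + s) / 2) ^ (ℓ - K) :=
                  Real.rpow_le_rpow_of_nonpos (by linarith) (by linarith) (by linarith)
              _ = _ := by
                  rw [Real.div_rpow (by linarith) (by norm_num), div_eq_mul_inv, mul_comm,
                    ← Real.rpow_neg two_pos.le, neg_sub]
          calc (1 + s ^ ℓ) * (B * (s⁻¹ ^ K * ‖y‖ ^ K))
              = B * ((1 + s ^ ℓ) * s⁻¹ ^ K) * ‖y‖ ^ K := by ring
            _ ≤ B * (2 * (2 ^ (K - ℓ) * (1 + s) ^ (ℓ - K))) * (1 + ‖y‖ ^ K) := by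
                have h4 : (1 + s ^ ℓ) * s⁻¹ ^ K ≤ 2 * (2 ^ (K - ℓ) * (1 + s) ^ (ℓ - K)) :=
                  (rpow_sub_le_of_one_le h hℓ).trans (by gcongr)
                refine mul_le_mul (mul_le_mul_of_nonneg_left h4 hB0) (by linarith)
                  (by positivity) (by positivity)
            _ = B * 2 * (2 ^ (K - ℓ) * (1 + s) ^ (ℓ - K) * (1 + ‖y‖ ^ K)) := by ring
            _ ≤ (A * 3 + B * 2) * (2 ^ (K - ℓ) * (1 + s) ^ (ℓ - K) * (1 + ‖y‖ ^ K)) := by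
                gcongr; linarith
            _ = _ := by ring
      _ = _ := ENNReal.ofReal_mul (by positivity)

/-- Dominated convergence in `y`. The bound by `|y / s|^K` gives a majorant that is a multiple of
`|ψ| (1 + |y|^K)`. At fixed `y`, once `s ≥ max(1, |y|)`, the bound by `|y / s|^{k+1}` leaves the
factor `s^{K-k-1}`, which tends to zero. -/
theorem HasDecay.tendsto_weightedNorm_conv_dilate {N n : ℕ} {p ℓ K : ℝ} {f : Space N → ℝ}
    (hf : HasDecay n p f) (hK : ⌊K⌋₊ + 1 ≤ n) (hℓ : 0 ≤ ℓ) (hℓK : ℓ ≤ K) (hp : N + K < p)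
    {ψ : Space N → ℝ} (hψ : MemWeightedL1 K ψ)
    (hmom : ∀ α : Fin N → ℕ, (order α : ℝ) ≤ K → ∫ y, monomial α y * ψ y = 0) :
    Tendsto (fun s : ℝ => ENNReal.ofReal (s ^ (K - ℓ)) * weightedNorm ℓ (conv (GenHeat.dilate s f) ψ))
      atTop (𝓝 0) := by
  have hN : (0 : ℝ) ≤ N := N.cast_nonneg
  have hK0 : 0 ≤ K := hℓ.trans hℓK
  set k := ⌊K⌋₊
  have hkK : (k : ℝ) ≤ K := Nat.floor_le hK0
  have hKk : K < (k : ℝ) + 1 := Nat.lt_floor_add_one K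
  obtain ⟨B, hB0, hB⟩ := hf.exists_remainderMass_le hK hkK hKk.le hℓ hℓK (by linarith)
  set F : ℝ → Space N → ℝ≥0∞ := fun s y => ‖ψ y‖ₑ * (ENNReal.ofReal (s ^ (K - ℓ) * (1 + s ^ ℓ)) *
    remainderMass k ℓ f (s⁻¹ • y)) with hF
  have hpow : ∀ s : ℝ, 1 ≤ s → s ^ (K - ℓ) * (1 + s ^ ℓ) ≤ 2 * s ^ K := by
    intro s hs
    have h1 : 1 ≤ s ^ ℓ := Real.one_le_rpow hs hℓ
    have h2 : s ^ K = s ^ (K - ℓ) * s ^ ℓ := by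
      rw [← Real.rpow_add (by linarith)]; simp
    rw [h2]
    nlinarith [Real.rpow_nonneg (by linarith : 0 ≤ s) (K - ℓ)]
  have hupper : ∀ᶠ s : ℝ in atTop,
      ENNReal.ofReal (s ^ (K - ℓ)) * weightedNorm ℓ (conv (GenHeat.dilate s f) ψ) ≤ ∫⁻ y, F s y := by
    filter_upwards [eventually_ge_atTop 1] with s hs
    have hs0 : 0 < s := by linarith
    refine (mul_le_mul_right (weightedNorm_conv_dilate_le_remainderMass hf (by omega) (by linarith)
      hkK hℓ hs0 hψ hmom) _).trans_eq ?_
    rw [← lintegral_const_mul' _ _ ENNReal.ofReal_ne_top]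
    congr 1; funext y
    rw [hF]
    dsimp only
    rw [ENNReal.ofReal_mul (by positivity)]
    ring
  refine tendsto_of_tendsto_of_tendsto_of_le_of_le' tendsto_const_nhds ?_
    (Eventually.of_forall fun s => zero_le) hupper
  have hlim : Tendsto (fun s => ∫⁻ y, F s y) atTop (𝓝 (∫⁻ _ : Space N, 0)) := by
    refine tendsto_lintegral_filter_of_dominated_convergence'
      (fun y => ENNReal.ofReal (2 * B) * (‖ψ y‖ₑ * weight K y)) (Eventually.of_forall fun s => ?_)
      ?_ ?_ (Eventually.of_forall fun y => ?_)
    · refine hψ.1.enorm.mul (Measurable.aemeasurable (Measurable.const_mul ?_ _))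
      exact (measurable_remainderMass hf.contDiff (by omega) ℓ).comp
        (measurable_const_smul s⁻¹)
    · filter_upwards [eventually_ge_atTop 1] with s hs
      have hs0 : 0 < s := by linarith
      refine Eventually.of_forall fun y => ?_
      rw [hF, mul_left_comm (ENNReal.ofReal (2 * B))]
      dsimp only
      gcongr ‖ψ y‖ₑ * ?_
      refine (mul_le_mul_right (hB _).1 _).trans ?_
      rw [weight, ← ENNReal.ofReal_mul (by positivity), ← ENNReal.ofReal_mul (by positivity)]
      refine ENNReal.ofReal_le_ofReal ?_
      rw [norm_smul, Real.norm_of_nonneg (by positivity),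
        Real.mul_rpow (by positivity) (by positivity)]
      calc s ^ (K - ℓ) * (1 + s ^ ℓ) * (B * (s⁻¹ ^ K * ‖y‖ ^ K))
          ≤ 2 * s ^ K * (B * (s⁻¹ ^ K * ‖y‖ ^ K)) :=
            mul_le_mul_of_nonneg_right (hpow s hs) (by positivity)
        _ = 2 * B * (s ^ K * s⁻¹ ^ K) * ‖y‖ ^ K := by ring
        _ = 2 * B * ‖y‖ ^ K := by
            rw [← Real.mul_rpow hs0.le (by positivity), mul_inv_cancel₀ hs0.ne', Real.one_rpow,
              mul_one]
        _ ≤ _ := by gcongr; linarith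
    · rw [lintegral_const_mul' _ _ ENNReal.ofReal_ne_top]
      exact ENNReal.mul_ne_top ENNReal.ofReal_ne_top hψ.2.ne
    · have hle : ∀ᶠ s : ℝ in atTop, F s y ≤ ‖ψ y‖ₑ *
          ENNReal.ofReal (2 * B * ‖y‖ ^ (k + 1) * s ^ (-((k : ℝ) + 1 - K))) := by
        filter_upwards [eventually_ge_atTop 1, eventually_ge_atTop ‖y‖] with s hs hy
        have hs0 : 0 < s := by linarith
        rw [hF]
        dsimp only
        gcongr ‖ψ y‖ₑ * ?_
        have hn : ‖s⁻¹ • y‖ = s⁻¹ * ‖y‖ := by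
          rw [norm_smul, Real.norm_of_nonneg (by positivity)]
        have hsy : ‖s⁻¹ • y‖ ≤ 1 := by
          rw [hn, inv_mul_le_iff₀ hs0]; simpa using hy
        refine (mul_le_mul_right ((hB _).2 hsy) _).trans ?_
        rw [← ENNReal.ofReal_mul (by positivity)]
        refine ENNReal.ofReal_le_ofReal ?_
        rw [hn, mul_pow]
        have he : s ^ K * s⁻¹ ^ (k + 1) = s ^ (-((k : ℝ) + 1 - K)) := by
          rw [inv_pow, ← Real.rpow_natCast, ← Real.rpow_neg hs0.le, ← Real.rpow_add hs0]
          congr 1; push_cast; ring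
        calc s ^ (K - ℓ) * (1 + s ^ ℓ) * (B * (s⁻¹ ^ (k + 1) * ‖y‖ ^ (k + 1)))
            ≤ 2 * s ^ K * (B * (s⁻¹ ^ (k + 1) * ‖y‖ ^ (k + 1))) :=
            mul_le_mul_of_nonneg_right (hpow s hs) (by positivity)
          _ = 2 * B * ‖y‖ ^ (k + 1) * (s ^ K * s⁻¹ ^ (k + 1)) := by ring
          _ = _ := by rw [he]
      refine tendsto_of_tendsto_of_tendsto_of_le_of_le' tendsto_const_nhds ?_
        (Eventually.of_forall fun s => zero_le) hle
      have h1 : Tendsto (fun s : ℝ => 2 * B * ‖y‖ ^ (k + 1) * s ^ (-((k : ℝ) + 1 - K))) atTop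
          (𝓝 0) := by
        simpa using (tendsto_rpow_neg_atTop (y := (k : ℝ) + 1 - K) (by linarith)).const_mul
          (2 * B * ‖y‖ ^ (k + 1))
      have h2 := ENNReal.tendsto_ofReal h1
      rw [ENNReal.ofReal_zero] at h2
      simpa using ENNReal.Tendsto.const_mul h2 (Or.inr enorm_ne_top)
  simpa using hlim

/-! ### Estimates for the remainder -/

namespace IsGeneralizedHeatKernel

variable {N γ : ℕ} {d L K ℓ : ℝ} {G : Space N → ℝ → ℝ}

theorem conv_dilate_eq_zero (h : ∀ x t, 0 < t → G x t = 0) (s : ℝ) (ψ : Space N → ℝ) :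
    conv (dilate s (fun y => G y 1)) ψ = fun _ => 0 := by
  funext x
  simp [conv, dilate, h _ _ one_pos]

theorem weightedNorm_zero (ℓ : ℝ) : weightedNorm ℓ (fun _ : Space N => (0 : ℝ)) = 0 := by
  simp [weightedNorm]

theorem exists_weightedNorm_conv_corrected_le (hG : IsGeneralizedHeatKernel γ d L G)
    (hKγ : ⌊K⌋₊ + 1 ≤ γ) (hKL : K < L) (hℓ : 0 ≤ ℓ) (hℓK : ℓ ≤ K) :
    ∃ C : ℝ, 0 ≤ C ∧ ∀ s : ℝ, 0 < s → ∀ φ : Space N → ℝ, MemWeightedL1 K φ →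
      weightedNorm ℓ (conv (dilate s (fun y => G y 1)) (corrected G K φ)) ≤
        ENNReal.ofReal (C * (1 + s) ^ (ℓ - K)) * weightedNorm K φ := by
  have hK0 : 0 ≤ K := hℓ.trans hℓK
  rcases hG.integral_eq_one_or_eq_zero with hm | hz
  · obtain ⟨A, hA0, hA⟩ := hG.hasDecay.exists_weightedNorm_conv_dilate_le hKγ hℓ hℓK (by linarith)
    obtain ⟨B, hB0, hB⟩ := hG.exists_weightedNorm_corrected_le hKγ hK0 hKL
    refine ⟨A * B, by positivity, fun s hs φ hφ => ?_⟩
    refine (hA s hs _ (hG.memWeightedL1_corrected hKγ hK0 hKL hφ) fun α hα =>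
      hG.integral_monomial_mul_corrected hKγ hK0 hKL hm hφ hα).trans ?_
    refine (mul_le_mul_right (hB φ hφ) _).trans_eq ?_
    rw [← mul_assoc, ← ENNReal.ofReal_mul (by positivity)]
    congr 2; ring
  -- Here the moments of the corrected datum need not vanish, but the kernel does.
  · refine ⟨0, le_rfl, fun s hs φ hφ => ?_⟩
    rw [conv_dilate_eq_zero hz, weightedNorm_zero]
    exact zero_le

theorem tendsto_weightedNorm_conv_corrected (hG : IsGeneralizedHeatKernel γ d L G)
    (hKγ : ⌊K⌋₊ + 1 ≤ γ) (hKL : K < L) (hℓ : 0 ≤ ℓ) (hℓK : ℓ ≤ K) {φ : Space N → ℝ}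
    (hφ : MemWeightedL1 K φ) :
    Tendsto (fun s : ℝ => ENNReal.ofReal (s ^ (K - ℓ)) *
      weightedNorm ℓ (conv (dilate s (fun y => G y 1)) (corrected G K φ))) atTop (𝓝 0) := by
  have hK0 : 0 ≤ K := hℓ.trans hℓK
  rcases hG.integral_eq_one_or_eq_zero with hm | hz
  · exact hG.hasDecay.tendsto_weightedNorm_conv_dilate hKγ hℓ hℓK (by linarith)
      (hG.memWeightedL1_corrected hKγ hK0 hKL hφ) fun α hα =>
      hG.integral_monomial_mul_corrected hKγ hK0 hKL hm hφ hα
  · simp only [conv_dilate_eq_zero hz, weightedNorm_zero, mul_zero]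
    exact tendsto_const_nhds

theorem rpow_div_eq {t : ℝ} (ht : 0 < t) (d a : ℝ) :
    t ^ (a / d) = 2 ^ (a / d) * ((t / 2) ^ (1 / d)) ^ a := by
  rw [← Real.rpow_mul (by positivity), one_div_mul_eq_div,
    ← Real.mul_rpow two_pos.le (by positivity)]
  congr 1; ring

/-- Both terms of the estimate are controlled by weighted norms at half the time. -/
theorem exists_norms_remainder_le (hG : IsGeneralizedHeatKernel γ d L G)
    (hKγ : ⌊K⌋₊ + 1 ≤ γ) (hKL : K < L) (hℓ : 0 ≤ ℓ) (hℓK : ℓ ≤ K) {j : ℕ} (hj : j ≤ γ)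
    {q : ℝ≥0∞} (hq : 1 ≤ q) :
    ∃ C : ℝ, 0 ≤ C ∧ ∀ φ : Space N → ℝ, MemWeightedL1 K φ → ∀ t : ℝ, 0 < t →
      ENNReal.ofReal (t ^ ((N : ℝ) / d * (1 - (q⁻¹).toReal) + j / d)) *
          eLpNorm (iteratedFDeriv ℝ j (remainder G K φ t)) q volume ≤
        ENNReal.ofReal C * weightedNorm 0
          (conv (dilate ((t / 2) ^ (1 / d)) (fun y => G y 1)) (corrected G K φ)) ∧
      ENNReal.ofReal (t ^ ((j : ℝ) / d)) *
          weightedNorm ℓ (iteratedFDeriv ℝ j (remainder G K φ t)) ≤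
        ENNReal.ofReal C * (weightedNorm ℓ
          (conv (dilate ((t / 2) ^ (1 / d)) (fun y => G y 1)) (corrected G K φ)) +
          ENNReal.ofReal (((t / 2) ^ (1 / d)) ^ ℓ) * weightedNorm 0
          (conv (dilate ((t / 2) ^ (1 / d)) (fun y => G y 1)) (corrected G K φ))) := by
  have hK0 : 0 ≤ K := hℓ.trans hℓK
  obtain ⟨A, hA0, hA⟩ := eLpNorm_iteratedFDeriv_conv_dilate_le hG.hasDecay hG.natCast_lt hj hq
  obtain ⟨B, hB0, hB⟩ := weightedNorm_iteratedFDeriv_conv_dilate_le (ℓ := ℓ) hG.hasDecay hℓ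
    (by linarith) hj
  -- Used only for finiteness: the solution at half time must be integrable before the smoothing
  -- estimates apply to it.
  obtain ⟨D, hD0, hD⟩ := hG.exists_weightedNorm_conv_corrected_le hKγ hKL le_rfl hK0
  set θ := (q⁻¹).toReal
  set e : ℝ := N * (1 - θ) + j
  refine ⟨2 ^ (e / d) * A + 2 ^ ((j : ℝ) / d) * B, by positivity, fun φ hφ t ht => ?_⟩
  have ht2 : 0 < t / 2 := by positivity
  have hσ : 0 < (t / 2) ^ (1 / d) := Real.rpow_pos_of_pos ht2 _
  have hψ := hG.memWeightedL1_corrected hKγ hK0 hKL hφ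
  have hrem : remainder G K φ t = conv (dilate ((t / 2) ^ (1 / d)) (fun y => G y 1))
      (conv (dilate ((t / 2) ^ (1 / d)) (fun y => G y 1)) (corrected G K φ)) := by
    rw [hG.remainder_eq hKγ hK0 hKL hφ ht, hG.conv_dilate_half ht hψ.integrable]
  rw [hrem]
  set σ := (t / 2) ^ (1 / d) with hσd
  set w := conv (dilate σ (fun y => G y 1)) (corrected G K φ)
  have hw0 : weightedNorm 0 w < ∞ :=
    (hD σ hσ φ hφ).trans_lt (ENNReal.mul_lt_top ENNReal.ofReal_lt_top hφ.2)
  have hwc : Continuous w :=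
    (contDiff_conv (hG.hasDecay_dilate hσ) hG.nonneg_exponent hψ.integrable).continuous
  have hw : Integrable w := MemWeightedL1.integrable ⟨hwc.aestronglyMeasurable, hw0⟩
  constructor
  · refine (mul_le_mul_right (hA σ hσ w hw) _).trans ?_
    rw [← mul_assoc, ← ENNReal.ofReal_mul (by positivity)]
    gcongr
    · have he : (N : ℝ) / d * (1 - θ) + j / d = e / d := by simp only [e]; ring
      rw [he, rpow_div_eq ht, ← hσd]
      calc 2 ^ (e / d) * σ ^ e * (A * σ ^ (-e))
          = 2 ^ (e / d) * A * (σ ^ e * σ ^ (-e)) := by ring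
        _ = 2 ^ (e / d) * A := by rw [← Real.rpow_add hσ]; simp
        _ ≤ _ := by linarith [show 0 ≤ (2 : ℝ) ^ ((j : ℝ) / d) * B by positivity]
    · exact lintegral_enorm_le_weightedNorm 0 w
  · refine (mul_le_mul_right (hB σ hσ w hw) _).trans ?_
    rw [← mul_assoc, ← ENNReal.ofReal_mul (by positivity)]
    gcongr
    · rw [rpow_div_eq ht, ← hσd, Real.rpow_natCast]
      calc 2 ^ ((j : ℝ) / d) * σ ^ j * (B * σ⁻¹ ^ j)
          = 2 ^ ((j : ℝ) / d) * B * (σ * σ⁻¹) ^ j := by rw [mul_pow]; ring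
        _ = 2 ^ ((j : ℝ) / d) * B := by rw [mul_inv_cancel₀ hσ.ne']; simp
        _ ≤ _ := by linarith [show 0 ≤ (2 : ℝ) ^ (e / d) * A by positivity]
    · exact lintegral_enorm_le_weightedNorm 0 w

/-- Converts decay in `σ = (t/2)^{1/d}` into decay in `t`. As `t = 2 σ^d`, one has `1 + t ≤ 3 (1 +
σ)^d`, and the nonpositive exponent reverses the inequality. -/
theorem one_add_rpow_le (hd : 0 < d) {a t : ℝ} (ha : a ≤ 0) (ht : 0 < t) :
    (1 + (t / 2) ^ (1 / d)) ^ a ≤ 3 ^ (-a / d) * (1 + t) ^ (a / d) := by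
  have hσ : 0 < (t / 2) ^ (1 / d) := by positivity
  set σ := (t / 2) ^ (1 / d) with hσd
  have h1 : t = 2 * σ ^ d := by
    rw [hσd, ← Real.rpow_mul (by positivity), one_div_mul_cancel hd.ne', Real.rpow_one]
    ring
  have h2 : 1 + t ≤ 3 * (1 + σ) ^ d := by
    have e1 : 1 ≤ (1 + σ) ^ d := Real.one_le_rpow (by linarith) hd.le
    have e2 : σ ^ d ≤ (1 + σ) ^ d := by gcongr; linarith
    linarith
  have h3 : (3 * (1 + σ) ^ d) ^ (a / d) ≤ (1 + t) ^ (a / d) :=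
    Real.rpow_le_rpow_of_nonpos (by positivity) h2 (div_nonpos_of_nonpos_of_nonneg ha hd.le)
  rw [Real.mul_rpow (by norm_num) (by positivity), ← Real.rpow_mul (by positivity),
    mul_div_cancel₀ _ hd.ne'] at h3
  calc (1 + σ) ^ a = 3 ^ (-a / d) * (3 ^ (a / d) * (1 + σ) ^ a) := by
        rw [← mul_assoc, ← Real.rpow_add (by norm_num)]
        ring_nf; simp
    _ ≤ _ := by gcongr

theorem exists_decay_estimate (hG : IsGeneralizedHeatKernel γ d L G)
    (hKγ : ⌊K⌋₊ + 1 ≤ γ) (hKL : K < L) (hℓ : 0 ≤ ℓ) (hℓK : ℓ ≤ K) {j : ℕ} (hj : j ≤ γ)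
    {q : ℝ≥0∞} (hq : 1 ≤ q) :
    ∃ C : ℝ, ∀ φ : Space N → ℝ, MemWeightedL1 K φ → ∀ t : ℝ, 0 < t →
      ENNReal.ofReal (t ^ ((N : ℝ) / d * (1 - (q⁻¹).toReal) + j / d)) *
          eLpNorm (iteratedFDeriv ℝ j (remainder G K φ t)) q volume +
        ENNReal.ofReal (t ^ ((j : ℝ) / d) * (1 + t) ^ (-(ℓ / d))) *
          weightedNorm ℓ (iteratedFDeriv ℝ j (remainder G K φ t))
      ≤ ENNReal.ofReal (C * (1 + t) ^ (-(K / d))) * weightedNorm K φ := by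
  have hK0 : 0 ≤ K := hℓ.trans hℓK
  have hd := hG.d_pos
  obtain ⟨C, hC0, hC⟩ := hG.exists_norms_remainder_le hKγ hKL hℓ hℓK hj hq
  obtain ⟨A, hA0, hA⟩ := hG.exists_weightedNorm_conv_corrected_le hKγ hKL le_rfl hK0
  obtain ⟨B, hB0, hB⟩ := hG.exists_weightedNorm_conv_corrected_le hKγ hKL hℓ hℓK
  set A' : ℝ := A * 3 ^ (-(0 - K) / d)
  set B' : ℝ := B * 3 ^ (-(ℓ - K) / d)
  refine ⟨C * (2 * A' + B'), fun φ hφ t ht => ?_⟩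
  obtain ⟨h1, h2⟩ := hC φ hφ t ht
  have hσ : 0 < (t / 2) ^ (1 / d) := by positivity
  have hA := hA _ hσ φ hφ
  have hB := hB _ hσ φ hφ
  have hsA := one_add_rpow_le hd (a := 0 - K) (by linarith) ht
  have hsB := one_add_rpow_le hd (a := ℓ - K) (by linarith) ht
  -- The growth `σ^ℓ` produced by the weighted smoothing estimate is exactly what the prefactor `(1
  -- + t)^{-ℓ/d}` compensates.
  have hσℓ : ((t / 2) ^ (1 / d)) ^ ℓ * (1 + t) ^ (-(ℓ / d)) ≤ 1 := by
    rw [← Real.rpow_mul (by positivity), one_div_mul_eq_div, Real.rpow_neg (by positivity),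
      ← div_eq_mul_inv, div_le_one (by positivity)]
    have : t / 2 ≤ 1 + t := by linarith
    gcongr
  set σ := (t / 2) ^ (1 / d)
  set w := conv (dilate σ (fun y => G y 1)) (corrected G K φ)
  set M := weightedNorm K φ
  set τ : ℝ := (1 + t) ^ (-(K / d))
  have hτ : 0 ≤ τ := by positivity
  have hw0 : weightedNorm 0 w ≤ ENNReal.ofReal (A' * τ) * M := by
    refine hA.trans ?_
    gcongr ENNReal.ofReal ?_ * M
    calc A * (1 + σ) ^ (0 - K) ≤ A * (3 ^ (-(0 - K) / d) * (1 + t) ^ ((0 - K) / d)) := by gcongr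
      _ = A' * τ := by simp only [A', τ]; ring_nf
  have hwℓ : ENNReal.ofReal ((1 + t) ^ (-(ℓ / d))) * weightedNorm ℓ w ≤
      ENNReal.ofReal (B' * τ) * M := by
    refine (mul_le_mul_right hB _).trans ?_
    rw [← mul_assoc, ← ENNReal.ofReal_mul (by positivity)]
    gcongr ENNReal.ofReal ?_ * M
    calc (1 + t) ^ (-(ℓ / d)) * (B * (1 + σ) ^ (ℓ - K))
        ≤ (1 + t) ^ (-(ℓ / d)) * (B * (3 ^ (-(ℓ - K) / d) * (1 + t) ^ ((ℓ - K) / d))) := by gcongr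
      _ = B' * ((1 + t) ^ (-(ℓ / d)) * (1 + t) ^ ((ℓ - K) / d)) := by ring
      _ = B' * τ := by
          rw [← Real.rpow_add (by positivity)]
          simp only [τ]; ring_nf
  have hwσ : ENNReal.ofReal ((1 + t) ^ (-(ℓ / d))) *
      (ENNReal.ofReal (σ ^ ℓ) * weightedNorm 0 w) ≤ ENNReal.ofReal (A' * τ) * M := by
    rw [← mul_assoc, ← ENNReal.ofReal_mul (by positivity)]
    calc _ ≤ 1 * weightedNorm 0 w := by
          gcongr
          exact ENNReal.ofReal_le_one.2 (by rw [mul_comm]; exact hσℓ)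
      _ ≤ _ := by rw [one_mul]; exact hw0
  have hsecond : ENNReal.ofReal (t ^ ((j : ℝ) / d) * (1 + t) ^ (-(ℓ / d))) *
      weightedNorm ℓ (iteratedFDeriv ℝ j (remainder G K φ t)) ≤
      ENNReal.ofReal C * (ENNReal.ofReal (B' * τ) * M + ENNReal.ofReal (A' * τ) * M) := by
    rw [mul_comm (t ^ ((j : ℝ) / d)), ENNReal.ofReal_mul (by positivity), mul_assoc]
    calc _ ≤ ENNReal.ofReal ((1 + t) ^ (-(ℓ / d))) * (ENNReal.ofReal C * (weightedNorm ℓ w +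
          ENNReal.ofReal (σ ^ ℓ) * weightedNorm 0 w)) := by gcongr
      _ = ENNReal.ofReal C * (ENNReal.ofReal ((1 + t) ^ (-(ℓ / d))) * weightedNorm ℓ w +
          ENNReal.ofReal ((1 + t) ^ (-(ℓ / d))) *
            (ENNReal.ofReal (σ ^ ℓ) * weightedNorm 0 w)) := by ring
      _ ≤ _ := by gcongr
  calc _ ≤ ENNReal.ofReal C * (ENNReal.ofReal (A' * τ) * M) +
        ENNReal.ofReal C * (ENNReal.ofReal (B' * τ) * M + ENNReal.ofReal (A' * τ) * M) :=
        add_le_add (h1.trans (by gcongr)) hsecond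
    _ = ENNReal.ofReal C * ((ENNReal.ofReal (A' * τ) + (ENNReal.ofReal (B' * τ) +
          ENNReal.ofReal (A' * τ))) * M) := by ring
    _ = _ := by
        rw [← ENNReal.ofReal_add (by positivity) (by positivity),
          ← ENNReal.ofReal_add (by positivity) (by positivity), ← mul_assoc,
          ← ENNReal.ofReal_mul hC0]
        congr 2; ring

theorem tendsto_decay (hG : IsGeneralizedHeatKernel γ d L G)
    (hKγ : ⌊K⌋₊ + 1 ≤ γ) (hKL : K < L) (hℓ : 0 ≤ ℓ) (hℓK : ℓ ≤ K) {j : ℕ} (hj : j ≤ γ)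
    {q : ℝ≥0∞} (hq : 1 ≤ q) {φ : Space N → ℝ} (hφ : MemWeightedL1 K φ) :
    Tendsto (fun t : ℝ =>
      ENNReal.ofReal (t ^ (K / d)) *
        (ENNReal.ofReal (t ^ ((N : ℝ) / d * (1 - (q⁻¹).toReal) + j / d)) *
            eLpNorm (iteratedFDeriv ℝ j (remainder G K φ t)) q volume +
          ENNReal.ofReal (t ^ (-(ℓ / d) + (j : ℝ) / d)) *
            weightedNorm ℓ (iteratedFDeriv ℝ j (remainder G K φ t))))
      atTop (𝓝 0) := by
  have hK0 : 0 ≤ K := hℓ.trans hℓK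
  have hd := hG.d_pos
  obtain ⟨C, hC0, hC⟩ := hG.exists_norms_remainder_le hKγ hKL hℓ hℓK hj hq
  have hσ : Tendsto (fun t : ℝ => (t / 2) ^ (1 / d)) atTop atTop :=
    (tendsto_rpow_atTop (by positivity)).comp (tendsto_id.atTop_div_const two_pos)
  have l0 := (hG.tendsto_weightedNorm_conv_corrected hKγ hKL le_rfl hK0 hφ).comp hσ
  have lℓ := (hG.tendsto_weightedNorm_conv_corrected hKγ hKL hℓ hℓK hφ).comp hσ
  simp only [Function.comp_def, sub_zero] at l0 lℓ
  set w : ℝ → Space N → ℝ := fun t =>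
    conv (dilate ((t / 2) ^ (1 / d)) (fun y => G y 1)) (corrected G K φ)
  -- The unweighted norm at half time occurs twice, once from the `L^q` term and once from the `σ^ℓ`
  -- term; hence the factor `2`. The powers of two come from replacing `t` by `t / 2`.
  have lim := ENNReal.Tendsto.const_mul (a := ENNReal.ofReal C)
    ((ENNReal.Tendsto.const_mul (a := 2 * ENNReal.ofReal (2 ^ (K / d))) l0
      (Or.inr (ENNReal.mul_ne_top (by simp) ENNReal.ofReal_ne_top))).add
    (ENNReal.Tendsto.const_mul (a := ENNReal.ofReal (2 ^ ((K - ℓ) / d))) lℓ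
      (Or.inr ENNReal.ofReal_ne_top))) (Or.inr ENNReal.ofReal_ne_top)
  simp only [mul_zero, add_zero] at lim
  refine tendsto_of_tendsto_of_tendsto_of_le_of_le' tendsto_const_nhds lim
    (Eventually.of_forall fun s => zero_le) ?_
  filter_upwards [eventually_gt_atTop 0] with t ht
  obtain ⟨h1, h2⟩ := hC φ hφ t ht
  have hσ0 : 0 < (t / 2) ^ (1 / d) := by positivity
  have hσℓ : t ^ (-(ℓ / d)) * ((t / 2) ^ (1 / d)) ^ ℓ ≤ 1 := by
    rw [← Real.rpow_mul (by positivity), one_div_mul_eq_div, Real.rpow_neg ht.le,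
      inv_mul_le_one₀ (by positivity)]
    have : t / 2 ≤ t := by linarith
    gcongr
  have hsplit : t ^ (K / d) * t ^ (-(ℓ / d)) = t ^ ((K - ℓ) / d) := by
    rw [← Real.rpow_add ht]; ring_nf
  have hK2 : ENNReal.ofReal (t ^ (K / d)) =
      ENNReal.ofReal (2 ^ (K / d)) * ENNReal.ofReal (((t / 2) ^ (1 / d)) ^ K) := by
    rw [rpow_div_eq ht, ENNReal.ofReal_mul (by positivity)]
  have hℓ2 : ENNReal.ofReal (t ^ ((K - ℓ) / d)) =
      ENNReal.ofReal (2 ^ ((K - ℓ) / d)) * ENNReal.ofReal (((t / 2) ^ (1 / d)) ^ (K - ℓ)) := by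
    rw [rpow_div_eq ht, ENNReal.ofReal_mul (by positivity)]
  rw [Real.rpow_add ht (-(ℓ / d)), ENNReal.ofReal_mul (p := t ^ (-(ℓ / d))) (by positivity),
    mul_assoc (ENNReal.ofReal (t ^ (-(ℓ / d))))]
  calc _ ≤ ENNReal.ofReal (t ^ (K / d)) * (ENNReal.ofReal C * weightedNorm 0 (w t) +
        ENNReal.ofReal (t ^ (-(ℓ / d))) * (ENNReal.ofReal C * (weightedNorm ℓ (w t) +
          ENNReal.ofReal (((t / 2) ^ (1 / d)) ^ ℓ) * weightedNorm 0 (w t)))) := by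
        gcongr
    _ = ENNReal.ofReal C * (ENNReal.ofReal (t ^ (K / d)) * weightedNorm 0 (w t) +
          (ENNReal.ofReal (t ^ (K / d)) * ENNReal.ofReal (t ^ (-(ℓ / d)))) * weightedNorm ℓ (w t) +
          ENNReal.ofReal (t ^ (K / d)) * ((ENNReal.ofReal (t ^ (-(ℓ / d))) *
            ENNReal.ofReal (((t / 2) ^ (1 / d)) ^ ℓ)) * weightedNorm 0 (w t))) := by ring
    _ ≤ ENNReal.ofReal C * (ENNReal.ofReal (t ^ (K / d)) * weightedNorm 0 (w t) +
          ENNReal.ofReal (t ^ ((K - ℓ) / d)) * weightedNorm ℓ (w t) +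
          ENNReal.ofReal (t ^ (K / d)) * (1 * weightedNorm 0 (w t))) := by
        rw [← ENNReal.ofReal_mul (by positivity), ← ENNReal.ofReal_mul (by positivity), hsplit]
        gcongr
        exact ENNReal.ofReal_le_one.2 hσℓ
    _ = _ := by
        rw [hK2, hℓ2]
        ring

theorem contDiff_remainder (hG : IsGeneralizedHeatKernel γ d L G)
    (hKγ : ⌊K⌋₊ + 1 ≤ γ) (hK0 : 0 ≤ K) (hKL : K < L) {φ : Space N → ℝ}
    (hφ : MemWeightedL1 K φ) {t : ℝ} (ht : 0 < t) : ContDiff ℝ γ (remainder G K φ t) := by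
  rw [hG.remainder_eq hKγ hK0 hKL hφ ht]
  exact contDiff_conv (hG.hasDecay_dilate (Real.rpow_pos_of_pos ht _)) hG.nonneg_exponent
    (hG.memWeightedL1_corrected hKγ hK0 hKL hφ).integrable

end IsGeneralizedHeatKernel

end

end GenHeat

theorem theorem1p1 {N : ℕ} (hN : 1 ≤ N) {γ : ℕ} {d L : ℝ}
    {G : GenHeat.Space N → ℝ → ℝ} (hG : GenHeat.IsGeneralizedHeatKernel γ d L G)
    {K : ℝ} (hK0 : 0 ≤ K) (hKL : K < L) (hKγ : ⌊K⌋₊ + 1 ≤ γ) :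
    (∀ φ : GenHeat.Space N → ℝ, GenHeat.MemWeightedL1 K φ → ∀ t : ℝ, 0 < t →
      ContDiff ℝ γ (GenHeat.remainder G K φ t)) ∧
    ∀ j : ℕ, j ≤ γ → ∀ q : ℝ≥0∞, 1 ≤ q → ∀ ℓ : ℝ, 0 ≤ ℓ → ℓ ≤ K →
      (∃ C : ℝ, ∀ φ : GenHeat.Space N → ℝ, GenHeat.MemWeightedL1 K φ → ∀ t : ℝ, 0 < t →
        ENNReal.ofReal (t ^ ((N : ℝ) / d * (1 - (q⁻¹).toReal) + j / d)) *
            eLpNorm (iteratedFDeriv ℝ j (GenHeat.remainder G K φ t)) q volume +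
          ENNReal.ofReal (t ^ ((j : ℝ) / d) * (1 + t) ^ (-(ℓ / d))) *
            GenHeat.weightedNorm ℓ (iteratedFDeriv ℝ j (GenHeat.remainder G K φ t))
        ≤ ENNReal.ofReal (C * (1 + t) ^ (-(K / d))) * GenHeat.weightedNorm K φ) ∧
      (∀ φ : GenHeat.Space N → ℝ, GenHeat.MemWeightedL1 K φ →
        Tendsto (fun t : ℝ =>
          ENNReal.ofReal (t ^ (K / d)) *
            (ENNReal.ofReal (t ^ ((N : ℝ) / d * (1 - (q⁻¹).toReal) + j / d)) *
                eLpNorm (iteratedFDeriv ℝ j (GenHeat.remainder G K φ t)) q volume +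
              ENNReal.ofReal (t ^ (-(ℓ / d) + (j : ℝ) / d)) *
                GenHeat.weightedNorm ℓ (iteratedFDeriv ℝ j (GenHeat.remainder G K φ t))))
          atTop (𝓝 0)) :=
  ⟨fun _ hφ _ ht => hG.contDiff_remainder hKγ hK0 hKL hφ ht, fun _ hj _ hq _ hℓ hℓK =>
    ⟨hG.exists_decay_estimate hKγ hKL hℓ hℓK hj hq,
      fun _ hφ => hG.tendsto_decay hKγ hKL hℓ hℓK hj hq hφ⟩⟩
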